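/- Let $\mathcal P_n=\{(p_1,\dots,p_n): \sum_i p_i=1,\ p_1\ge\dots\ge p_n\ge 0\}$, ordered by majorization: $p\preceq q$ iff $\sum_{k\le i}p_k\le\sum_{k\le i}q_k$ for $i=1,\dots,n$. For $p,q\in\mathcal P_n$ let $p\wedge q$ be their greatest lower bound in $(\mathcal P_n,\preceq)$, let $\mathcal C(p,q)$ be the set of couplings of $p$ and $q$, that is, of the $n\times n$ matrices $M=[m_{ij}]$ with non-negative entries, $\sum_j m_{ij}=p_i$ for all $i$ and $\sum_i m_{ij}=q_j$ for all $j$, and let $H$ be the Shannon entropy in bits ($H(x)=\sum_i x_i\log_2\frac1{x_i}$ with $0\log_2\frac10=0$, and similarly for matrices). Consider the following algorithm, with input $p,q\in\mathcal P_n$. 1. Set $m_{ij}\leftarrow 0$, $R[i]\leftarrow 0$, $C[i]\leftarrow 0$ for all $i,j$. If $p\ne q$ and $p_i<q_i$ for the largest $i$ with $p_i\neq q_i$, exchange $p$ and $q$. 2. Compute the inversion points $i_0=n+1>i_1>\dots>i_k=1$: for odd (even) $s$, $i_s$ is the least index below $i_{s-1}$ such that $\sum_{h=i}^n p_h\ge\sum_{h=i}^n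 q_h$ (respectively $\le$) for all $i$ with $i_s\le i<i_{s-1}$. Compute $z=p\wedge q$. 3. For $s=1,\dots,k$: * If $s$ is odd, do the following for $j=i_{s-1}-1$ down to $i_s$. Call Split$(z_j,q_j,R[j+1..i_{s-1}-1])$, which returns $(z^{(d)},z^{(r)},Q)$; for each $\ell\in Q$ set $m_{\ell j}\leftarrow R[\ell]$, $R[\ell]\leftarrow 0$; then set $m_{jj}\leftarrow z^{(d)}$, $R[j]\leftarrow z^{(r)}$. After this loop, if $i_s\ne1$, then for each $\ell\in[i_s..i_{s-1}-1]$ with $R[\ell]\ne0$ set $m_{\ell,i_s-1}\leftarrow R[\ell]$, $R[\ell]\leftarrow 0$. * If $s$ is even, do the same with $p_j$ in place of $q_j$, $C$ in place of $R$, and the two indices of $m$ exchanged. 4. Output $M=[m_{ij}]$, transposed if $p$ and $q$ were exchanged in step 1. Here Split$(z,x,A[a..b])$ starts with $h\leftarrow a$, $Q\leftarrow\emptyset$, $\mathit{sum}\leftarrow0$; while $h\le b$ and $\mathit{sum}+A[h]<x$, it adds $h$ to $Q$, adds $A[h]$ to $\mathit{sum}$ and increases $h$ by one; then it returns $z^{(d)}=x-\mathit{sum}$,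 $z^{(r)}=z-z^{(d)}$ and $Q$. **Theorem.** For all $n$ and all $p,q\in\mathcal P_n$, this algorithm runs in polynomial time, namely in $O(n^2)$ steps, with an absolute constant, on a random access machine that performs each elementary operation (addition, subtraction, comparison or copying of real numbers and of indices, parity test of an index, memory access) in one step. Its output is a matrix $M\in\mathcal C(p,q)$ such that $$H(M)\le H(p\wedge q)+1 .$$ Consequently $H(M)\le OPT+1$, where $OPT=\min_{N\in\mathcal C(p,q)}H(N)$; that is, the algorithm is an additive $1$-approximation for the minimum-entropy coupling. -/

import Mathlib

/-! ### Ordered probability vectors, majorization, entropy, couplings -/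

/-- Probability vectors with `n` components, listed in non-increasing order. -/
@[ext] structure OrdProb (n : ℕ) where
  val : Fin n → ℝ
  nonneg : ∀ i, 0 ≤ val i
  sum_eq_one : ∑ i, val i = 1
  antitone : Antitone val

/-- Majorization: `p ≤ q` iff every initial sum of `p` is at most that of `q`. -/
instance OrdProb.instPartialOrder (n : ℕ) : PartialOrder (OrdProb n) where
  le p q := ∀ i : Fin n, ∑ j ∈ Finset.Iic i, p.val j ≤ ∑ j ∈ Finset.Iic i, q.val j
  le_refl _ _ := le_rfl
  le_trans _ _ _ h₁ h₂ i := (h₁ i).trans (h₂ i)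
  le_antisymm p q h₁ h₂ := by
    have key : ∀ (k : ℕ) (hk : k < n), p.val ⟨k, hk⟩ = q.val ⟨k, hk⟩ := by
      intro k
      induction k using Nat.strong_induction_on with
      | _ k ih =>
        intro hk
        have h := le_antisymm (h₁ ⟨k, hk⟩) (h₂ ⟨k, hk⟩)
        rw [← Finset.Iio_insert, Finset.sum_insert (by simp), Finset.sum_insert (by simp)] at h
        have h' : ∑ j ∈ Finset.Iio (⟨k, hk⟩ : Fin n), p.val j
            = ∑ j ∈ Finset.Iio (⟨k, hk⟩ : Fin n), q.val j :=
          Finset.sum_congr rfl fun j hj => ih j.1 (Fin.lt_def.1 (Finset.mem_Iio.1 hj)) j.2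
        linarith
    exact OrdProb.ext (funext fun i => key i.1 i.2)

/-- Shannon entropy in bits; a term with `x i = 0` contributes `0`. -/
noncomputable def entropy {ι : Type*} [Fintype ι] (x : ι → ℝ) : ℝ :=
  ∑ i, x i * Real.logb 2 (1 / x i)

/-- The entropy of a bivariate distribution, given as a matrix. -/
noncomputable def matEntropy {n : ℕ} (M : Matrix (Fin n) (Fin n) ℝ) : ℝ :=
  entropy fun ij : Fin n × Fin n => M ij.1 ij.2

/-- The couplings of `p` and `q`: joint distributions with row sums `p` and column sums `q`. -/
def couplings {n : ℕ} (p q : OrdProb n) : Set (Matrix (Fin n) (Fin n) ℝ) :=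
  {M | (∀ i j, 0 ≤ M i j) ∧ (∀ i, ∑ j, M i j = p.val i) ∧ (∀ j, ∑ i, M i j = q.val j)}

/-! ### A real-number random access machine with unit costs

Programs of a small imperative language over integer variables, real variables, and arrays of
integers and of reals. The only operations on reals are addition, subtraction, comparison and
copying; the only operations on integers are addition, truncated subtraction, comparison and the
parity test. Each node of an expression and each elementary command costs one step. -/

/-- Integer variables. -/
inductive NVar | n | i | j | k | l | s | t | c | sw
  deriving DecidableEq

/-- Real variables. -/
inductive RVar | sum | zd | zr | tmp
  deriving DecidableEq

/-- Arrays of integers. -/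
inductive NArr | inv | Q
  deriving DecidableEq

/-- Arrays of reals. -/
inductive RArr | p | q | sp | sq | smax | z | R | C
  deriving DecidableEq

/-- Two-dimensional arrays of reals. -/
inductive MArr | m | out
  deriving DecidableEq

/-- Memory contents. -/
structure State where
  nat : NVar → ℕ
  real : RVar → ℝ
  narr : NArr → ℕ → ℕ
  rarr : RArr → ℕ → ℝ
  mat : MArr → ℕ → ℕ → ℝ

/-- Integer expressions. -/
inductive NExp
  | lit (c : ℕ)
  | var (x : NVar)
  | get (a : NArr) (e : NExp)
  | add (e f : NExp)
  | sub (e f : NExp)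

/-- Real expressions. -/
inductive RExp
  | zero
  | var (x : RVar)
  | get (a : RArr) (e : NExp)
  | getm (a : MArr) (e f : NExp)
  | add (e f : RExp)
  | sub (e f : RExp)

/-- Boolean expressions. -/
inductive BExp
  | ieq (e f : NExp)
  | ile (e f : NExp)
  | odd (e : NExp)
  | req (e f : RExp)
  | rle (e f : RExp)
  | rlt (e f : RExp)
  | and (a b : BExp)
  | not (a : BExp)

/-- Commands. -/
inductive Stmt
  | skip
  | setN (x : NVar) (e : NExp)
  | setR (x : RVar) (e : RExp)
  | putN (a : NArr) (e f : NExp)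
  | putR (a : RArr) (e : NExp) (v : RExp)
  | putM (a : MArr) (e f : NExp) (v : RExp)
  | seq (c d : Stmt)
  | ite (b : BExp) (c d : Stmt)
  | while (b : BExp) (c : Stmt)

def NExp.eval (σ : State) : NExp → ℕ
  | lit c => c
  | var x => σ.nat x
  | get a e => σ.narr a (e.eval σ)
  | add e f => e.eval σ + f.eval σ
  | sub e f => e.eval σ - f.eval σ

noncomputable def RExp.eval (σ : State) : RExp → ℝ
  | zero => 0
  | var x => σ.real x
  | get a e => σ.rarr a (e.eval σ)
  | getm a e f => σ.mat a (e.eval σ) (f.eval σ)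
  | add e f => e.eval σ + f.eval σ
  | sub e f => e.eval σ - f.eval σ

def BExp.eval (σ : State) : BExp → Prop
  | ieq e f => e.eval σ = f.eval σ
  | ile e f => e.eval σ ≤ f.eval σ
  | odd e => Odd (e.eval σ)
  | req e f => e.eval σ = f.eval σ
  | rle e f => e.eval σ ≤ f.eval σ
  | rlt e f => e.eval σ < f.eval σ
  | and a b => a.eval σ ∧ b.eval σ
  | not a => ¬ a.eval σ

/-- Number of steps needed to evaluate an integer expression: its number of nodes. -/
def NExp.cost : NExp → ℕ
  | lit _ => 1
  | var _ => 1
  | get _ e => e.cost + 1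
  | add e f => e.cost + f.cost + 1
  | sub e f => e.cost + f.cost + 1

/-- Number of steps needed to evaluate a real expression: its number of nodes. -/
def RExp.cost : RExp → ℕ
  | zero => 1
  | var _ => 1
  | get _ e => e.cost + 1
  | getm _ e f => e.cost + f.cost + 1
  | add e f => e.cost + f.cost + 1
  | sub e f => e.cost + f.cost + 1

/-- Number of steps needed to evaluate a Boolean expression: its number of nodes. -/
def BExp.cost : BExp → ℕ
  | ieq e f => e.cost + f.cost + 1
  | ile e f => e.cost + f.cost + 1
  | odd e => e.cost + 1
  | req e f => e.cost + f.cost + 1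
  | rle e f => e.cost + f.cost + 1
  | rlt e f => e.cost + f.cost + 1
  | and a b => a.cost + b.cost + 1
  | not a => a.cost + 1

def State.setN (σ : State) (x : NVar) (v : ℕ) : State :=
  { σ with nat := Function.update σ.nat x v }

def State.setR (σ : State) (x : RVar) (v : ℝ) : State :=
  { σ with real := Function.update σ.real x v }

def State.putN (σ : State) (a : NArr) (i v : ℕ) : State :=
  { σ with narr := Function.update σ.narr a (Function.update (σ.narr a) i v) }

def State.putR (σ : State) (a : RArr) (i : ℕ) (v : ℝ) : State :=
  { σ with rarr := Function.update σ.rarr a (Function.update (σ.rarr a) i v) }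

def State.putM (σ : State) (a : MArr) (i j : ℕ) (v : ℝ) : State :=
  { σ with
    mat := Function.update σ.mat a
      (Function.update (σ.mat a) i (Function.update (σ.mat a i) j v)) }

/-- `Exec c σ τ T`: the command `c`, started in the memory `σ`, halts in the memory `τ` after
exactly `T` steps. -/
inductive Exec : Stmt → State → State → ℕ → Prop
  | skip (σ : State) : Exec .skip σ σ 1
  | setN (x : NVar) (e : NExp) (σ : State) :
      Exec (.setN x e) σ (σ.setN x (e.eval σ)) (e.cost + 1)
  | setR (x : RVar) (e : RExp) (σ : State) :
      Exec (.setR x e) σ (σ.setR x (e.eval σ)) (e.cost + 1)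
  | putN (a : NArr) (e f : NExp) (σ : State) :
      Exec (.putN a e f) σ (σ.putN a (e.eval σ) (f.eval σ)) (e.cost + f.cost + 1)
  | putR (a : RArr) (e : NExp) (v : RExp) (σ : State) :
      Exec (.putR a e v) σ (σ.putR a (e.eval σ) (v.eval σ)) (e.cost + v.cost + 1)
  | putM (a : MArr) (e f : NExp) (v : RExp) (σ : State) :
      Exec (.putM a e f v) σ (σ.putM a (e.eval σ) (f.eval σ) (v.eval σ))
        (e.cost + f.cost + v.cost + 1)
  | seq {c d : Stmt} {σ τ υ : State} {T U : ℕ} (h₁ : Exec c σ τ T) (h₂ : Exec d τ υ U) :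
      Exec (.seq c d) σ υ (T + U)
  | iteTrue {b : BExp} {c : Stmt} (d : Stmt) {σ τ : State} {T : ℕ} (hb : b.eval σ)
      (h : Exec c σ τ T) : Exec (.ite b c d) σ τ (b.cost + 1 + T)
  | iteFalse {b : BExp} (c : Stmt) {d : Stmt} {σ τ : State} {T : ℕ} (hb : ¬ b.eval σ)
      (h : Exec d σ τ T) : Exec (.ite b c d) σ τ (b.cost + 1 + T)
  | whileFalse {b : BExp} (c : Stmt) {σ : State} (hb : ¬ b.eval σ) :
      Exec (.while b c) σ σ (b.cost + 1)
  | whileTrue {b : BExp} {c : Stmt} {σ τ υ : State} {T U : ℕ} (hb : b.eval σ)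
      (h₁ : Exec c σ τ T) (h₂ : Exec (.while b c) τ υ U) :
      Exec (.while b c) σ υ (b.cost + 1 + T + U)

/-- Execution is deterministic: the final memory and the number of steps are determined by the
program and the initial memory. -/
theorem Exec.deterministic {c : Stmt} {σ τ τ' : State} {T T' : ℕ}
    (h : Exec c σ τ T) (h' : Exec c σ τ' T') : τ = τ' ∧ T = T' := by
  induction h generalizing τ' T' with
  | seq _ _ ih₁ ih₂ =>
    cases h' with
    | seq g₁ g₂ =>
      obtain ⟨rfl, rfl⟩ := ih₁ g₁
      obtain ⟨rfl, rfl⟩ := ih₂ g₂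
      exact ⟨rfl, rfl⟩
  | iteTrue _ hb _ ih =>
    cases h' with
    | iteTrue _ _ g =>
      obtain ⟨rfl, rfl⟩ := ih g
      exact ⟨rfl, rfl⟩
    | iteFalse _ hb' _ => exact absurd hb hb'
  | iteFalse _ hb _ ih =>
    cases h' with
    | iteFalse _ _ g =>
      obtain ⟨rfl, rfl⟩ := ih g
      exact ⟨rfl, rfl⟩
    | iteTrue _ hb' _ => exact absurd hb' hb
  | whileFalse _ hb =>
    cases h' with
    | whileFalse _ _ => exact ⟨rfl, rfl⟩
    | whileTrue hb' _ _ => exact absurd hb' hb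
  | whileTrue hb _ _ ih₁ ih₂ =>
    cases h' with
    | whileFalse _ hb' => exact absurd hb hb'
    | whileTrue _ g₁ g₂ =>
      obtain ⟨rfl, rfl⟩ := ih₁ g₁
      obtain ⟨rfl, rfl⟩ := ih₂ g₂
      exact ⟨rfl, rfl⟩
  | _ => cases h'; exact ⟨rfl, rfl⟩

/-! ### The algorithm -/

namespace MinEntropy

instance (c : ℕ) : OfNat NExp c := ⟨.lit c⟩
instance : Add NExp := ⟨.add⟩
instance : Sub NExp := ⟨.sub⟩
instance : Add RExp := ⟨.add⟩
instance : Sub RExp := ⟨.sub⟩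

abbrev n : NExp := .var .n
abbrev i : NExp := .var .i
abbrev j : NExp := .var .j
abbrev k : NExp := .var .k
abbrev l : NExp := .var .l
abbrev s : NExp := .var .s
abbrev t : NExp := .var .t
abbrev c : NExp := .var .c
abbrev sw : NExp := .var .sw
abbrev inv (e : NExp) : NExp := .get .inv e

/-- Sequential composition of a list of commands. -/
def block : List Stmt → Stmt
  | [] => .skip
  | a :: as => .seq a (block as)

/-- A conditional without `else` part. -/
def when (b : BExp) (body : Stmt) : Stmt := .ite b body .skip

/-- `for x = a to b do body`. -/
def forUp (x : NVar) (a b : NExp) (body : Stmt) : Stmt :=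
  block [.setN x a, .while (.ile (.var x) b) (block [body, .setN x (.var x + 1)])]

/-- `for x = a downto b do body` (used with `b ≥ 1`). -/
def forDown (x : NVar) (a b : NExp) (body : Stmt) : Stmt :=
  block [.setN x a, .while (.ile b (.var x)) (block [body, .setN x (.var x - 1)])]

/-- Set the matrix `m` and the arrays `R` and `C` to zero. -/
def clear : Stmt :=
  block [
    forUp .i 1 n (forUp .j 1 n (.putM .m i j .zero)),
    forUp .i 1 n (block [.putR .R i .zero, .putR .C i .zero])]

/-- If `p ≠ q` and `p i < q i` for the last index `i` with `p i ≠ q i`, exchange `p` and `q`;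
the flag `sw` records whether this has been done. -/
def orient : Stmt :=
  block [
    .setN .sw 0,
    .setN .i n,
    .while (.and (.ile 1 i) (.req (.get .p i) (.get .q i))) (.setN .i (i - 1)),
    when (.and (.ile 1 i) (.rlt (.get .p i) (.get .q i))) (block [
      .setN .sw 1,
      forUp .i 1 n (block [
        .setR .tmp (.get .p i),
        .putR .p i (.get .q i),
        .putR .q i (.var .tmp)])])]

/-- The suffix sums `sp i = p i + ⋯ + p n` and `sq i = q i + ⋯ + q n`. -/
def suffixSums : Stmt :=
  block [
    .putR .sp (n + 1) .zero,
    .putR .sq (n + 1) .zero,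
    forDown .i n 1 (block [
      .putR .sp i (.get .sp (i + 1) + .get .p i),
      .putR .sq i (.get .sq (i + 1) + .get .q i)])]

/-- The inversion points `inv 0 = n + 1 > inv 1 > ⋯ > inv k = 1`: the point `inv s` is the least
index below `inv (s - 1)` such that `sp i ≥ sq i` (for odd `s`), respectively `sp i ≤ sq i`
(for even `s`), for all `i` with `inv s ≤ i < inv (s - 1)`. -/
def inversionPoints : Stmt :=
  block [
    .setN .k 0,
    .putN .inv 0 (n + 1),
    .setN .i (n + 1),
    .while (.not (.ieq i 1)) (block [
      .setN .k (k + 1),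
      .ite (.odd k)
        (.while (.and (.ile 2 i) (.rle (.get .sq (i - 1)) (.get .sp (i - 1)))) (.setN .i (i - 1)))
        (.while (.and (.ile 2 i) (.rle (.get .sp (i - 1)) (.get .sq (i - 1)))) (.setN .i (i - 1))),
      .putN .inv k i])]

/-- The vector `z = p ∧ q`, whose suffix sums are the maxima of those of `p` and `q`. -/
def meet : Stmt :=
  block [
    .putR .smax (n + 1) .zero,
    forDown .i n 1 (block [
      .ite (.rle (.get .sq i) (.get .sp i))
        (.putR .smax i (.get .sp i))
        (.putR .smax i (.get .sq i)),
      .putR .z i (.get .smax i - .get .smax (i + 1))])]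

/-- The splitting procedure, on `z`, `x` and the part `A[lo..hi]` of an array. It computes
`zd + zr = z` and a set `Q` of indices, listed as `Q[1..c]`. -/
def split (z x : RExp) (A : RArr) (lo hi : NExp) : Stmt :=
  block [
    .setN .l lo,
    .setN .c 0,
    .setR .sum .zero,
    .while (.and (.ile l hi) (.rlt (.var .sum + .get A l) x)) (block [
      .setN .c (c + 1),
      .putN .Q c l,
      .setR .sum (.var .sum + .get A l),
      .setN .l (l + 1)]),
    .setR .zd (x - .var .sum),
    .setR .zr (z - .var .zd)]

/-- The body of the main loop for odd `s`. -/
def oddSegment : Stmt :=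
  block [
    forDown .j (inv (s - 1) - 1) (inv s) (block [
      split (.get .z j) (.get .q j) .R (j + 1) (inv (s - 1) - 1),
      forUp .t 1 c (block [
        .setN .l (.get .Q t),
        .putM .m l j (.get .R l),
        .putR .R l .zero]),
      .putM .m j j (.var .zd),
      .putR .R j (.var .zr)]),
    when (.not (.ieq (inv s) 1))
      (forUp .l (inv s) (inv (s - 1) - 1)
        (when (.not (.req (.get .R l) .zero)) (block [
          .putM .m l (inv s - 1) (.get .R l),
          .putR .R l .zero])))]

/-- The body of the main loop for even `s`. -/
def evenSegment : Stmt :=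
  block [
    forDown .j (inv (s - 1) - 1) (inv s) (block [
      split (.get .z j) (.get .p j) .C (j + 1) (inv (s - 1) - 1),
      forUp .t 1 c (block [
        .setN .l (.get .Q t),
        .putM .m j l (.get .C l),
        .putR .C l .zero]),
      .putM .m j j (.var .zd),
      .putR .C j (.var .zr)]),
    when (.not (.ieq (inv s) 1))
      (forUp .l (inv s) (inv (s - 1) - 1)
        (when (.not (.req (.get .C l) .zero)) (block [
          .putM .m (inv s - 1) l (.get .C l),
          .putR .C l .zero])))]

/-- Copy `m` to `out`, transposed if `p` and `q` have been exchanged. -/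
def writeOutput : Stmt :=
  forUp .i 1 n (forUp .j 1 n
    (.ite (.ieq sw 0)
      (.putM .out i j (.getm .m i j))
      (.putM .out i j (.getm .m j i))))

/-- The algorithm `Min-Entropy-Joint-Distribution`. -/
def algorithm : Stmt :=
  block [
    clear,
    orient,
    suffixSums,
    inversionPoints,
    meet,
    forUp .s 1 k (.ite (.odd s) oddSegment evenSegment),
    writeOutput]

/-- The memory `σ` contains the input: the number `n` and the vectors `p` and `q`, in the cells
`1, …, n` of the arrays of that name. The rest of the memory is arbitrary. -/
def HasInput {n : ℕ} (σ : State) (p q : OrdProb n) : Prop :=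
  σ.nat .n = n ∧ ∀ i : Fin n, σ.rarr .p (i + 1) = p.val i ∧ σ.rarr .q (i + 1) = q.val i

/-- The `n × n` matrix in the cells `(1, 1), …, (n, n)` of the array `out`. -/
def result (n : ℕ) (τ : State) : Matrix (Fin n) (Fin n) ℝ :=
  Matrix.of fun i j => τ.mat .out (i + 1) (j + 1)

end MinEntropy

/-! Let `u h` be the larger of the sums of the components of `p` and of `q` with index at least `h`.
The differences `z h = u h - u (h + 1)` are the components of `p ∧ q`, because the prefix sums of
the meet are the minima of those of `p` and `q`.

Upper bound. The algorithm cuts each `z h` into at most two pieces: one goes into the diagonal cell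
`(h, h)`, the other waits as a remainder and is later moved, undivided, into one cell. By concavity,
splitting a mass `x` in two costs at most `x` bits (`entropyTerm_add_le`), so the final matrix has
entropy at most `H(z)` plus the total mass `1` of `z`. The invariant `PartialCoupling` records this
together with the marginals. It is preserved by one column (`PartialCoupling.step`) and by the
passage to the next segment (`PartialCoupling.carry`), where rows and columns exchange roles; after
the last segment no remainder is left (`PartialCoupling.full`). The delicate point is that the
diagonal piece lies between `0` and `z h`. This uses that `z` is non-increasing and that the sum of
the outstanding remainders is known exactly.

Lower bound. Any `k` cells of a coupling lie in at most `k` rows and at most `k` columns, so their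
sum is at most the `k`-th prefix sum of `p ∧ q`. Hence the sorted entries of the coupling are
majorized by `p ∧ q` padded with zeros, and Schur concavity gives `H(p ∧ q) ≤ H(N)` for every
coupling `N` (`entropy_meet_le`). `OPT` is attained because the couplings form a compact set.

Running time. The program is verified by a Hoare calculus whose loop invariants carry a budget of
steps. A column costs `O(n)`, the segments share `n` columns, and there are at most `n + 1`
segments, each with `O(n)` overhead. -/

/-! ### Total correctness with time bounds -/

/-- `Run c σ Q`: the command `c`, started in `σ`, halts in a memory and after a number of steps
that satisfy `Q`. -/
def Run (c : Stmt) (σ : State) (Q : State → ℕ → Prop) : Prop :=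
  ∃ τ T, Exec c σ τ T ∧ Q τ T

theorem Run.mono {c : Stmt} {σ : State} {Q Q' : State → ℕ → Prop} (h : Run c σ Q)
    (hQ : ∀ τ T, Q τ T → Q' τ T) : Run c σ Q' := by
  obtain ⟨τ, T, h, hq⟩ := h
  exact ⟨τ, T, h, hQ _ _ hq⟩

/-- This rule and its companions are equivalences, so that rewriting with them executes
straight-line code symbolically. -/
theorem run_skip {σ : State} {Q : State → ℕ → Prop} : Run .skip σ Q ↔ Q σ 1 :=
  ⟨fun ⟨_, _, h, hq⟩ => by cases h; exact hq, fun h => ⟨_, _, .skip σ, h⟩⟩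

theorem run_setN {x e} {σ : State} {Q : State → ℕ → Prop} :
    Run (.setN x e) σ Q ↔ Q (σ.setN x (e.eval σ)) (e.cost + 1) :=
  ⟨fun ⟨_, _, h, hq⟩ => by cases h; exact hq, fun h => ⟨_, _, .setN x e σ, h⟩⟩

theorem run_setR {x e} {σ : State} {Q : State → ℕ → Prop} :
    Run (.setR x e) σ Q ↔ Q (σ.setR x (e.eval σ)) (e.cost + 1) :=
  ⟨fun ⟨_, _, h, hq⟩ => by cases h; exact hq, fun h => ⟨_, _, .setR x e σ, h⟩⟩

theorem run_putN {a e f} {σ : State} {Q : State → ℕ → Prop} :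
    Run (.putN a e f) σ Q ↔ Q (σ.putN a (e.eval σ) (f.eval σ)) (e.cost + f.cost + 1) :=
  ⟨fun ⟨_, _, h, hq⟩ => by cases h; exact hq, fun h => ⟨_, _, .putN a e f σ, h⟩⟩

theorem run_putR {a e f} {σ : State} {Q : State → ℕ → Prop} :
    Run (.putR a e f) σ Q ↔ Q (σ.putR a (e.eval σ) (f.eval σ)) (e.cost + f.cost + 1) :=
  ⟨fun ⟨_, _, h, hq⟩ => by cases h; exact hq, fun h => ⟨_, _, .putR a e f σ, h⟩⟩

theorem run_putM {a e f v} {σ : State} {Q : State → ℕ → Prop} :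
    Run (.putM a e f v) σ Q ↔
      Q (σ.putM a (e.eval σ) (f.eval σ) (v.eval σ)) (e.cost + f.cost + v.cost + 1) :=
  ⟨fun ⟨_, _, h, hq⟩ => by cases h; exact hq, fun h => ⟨_, _, .putM a e f v σ, h⟩⟩

theorem run_seq {c d : Stmt} {σ : State} {Q : State → ℕ → Prop} :
    Run (.seq c d) σ Q ↔ Run c σ fun τ T => Run d τ fun υ U => Q υ (T + U) :=
  ⟨fun ⟨_, _, h, hq⟩ => by cases h with | seq h₁ h₂ => exact ⟨_, _, h₁, _, _, h₂, hq⟩,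
    fun ⟨_, _, h₁, _, _, h₂, hq⟩ => ⟨_, _, .seq h₁ h₂, hq⟩⟩

theorem run_ite {b : BExp} {c d : Stmt} {σ : State} {Q : State → ℕ → Prop} :
    Run (.ite b c d) σ Q ↔ (b.eval σ → Run c σ fun τ T => Q τ (b.cost + 1 + T)) ∧
      (¬ b.eval σ → Run d σ fun τ T => Q τ (b.cost + 1 + T)) := by
  constructor
  · rintro ⟨_, _, h, hq⟩
    cases h with
    | iteTrue _ hb h => exact ⟨fun _ => ⟨_, _, h, hq⟩, fun hb' => absurd hb hb'⟩
    | iteFalse _ hb h => exact ⟨fun hb' => absurd hb' hb, fun _ => ⟨_, _, h, hq⟩⟩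
  · rintro ⟨h₁, h₂⟩
    by_cases hb : b.eval σ
    · obtain ⟨τ, T, h, hq⟩ := h₁ hb
      exact ⟨_, _, .iteTrue d hb h, hq⟩
    · obtain ⟨τ, T, h, hq⟩ := h₂ hb
      exact ⟨_, _, .iteFalse c hb h, hq⟩

/-- A loop, with an invariant `I` that bounds the number of steps still to be made. -/
theorem run_while {b : BExp} {c : Stmt} (I : ℕ → State → Prop)
    (h : ∀ B σ, I B σ → b.eval σ →
      Run c σ fun τ T => ∃ B', b.cost + 1 + T + B' ≤ B ∧ I B' τ)
    {B : ℕ} {σ : State} (h₀ : I B σ) :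
    Run (.while b c) σ fun τ T => T ≤ B + b.cost + 1 ∧ ¬ b.eval τ ∧ ∃ B', I B' τ := by
  -- The budget doubles as termination measure: every iteration takes at least `b.cost + 1` steps,
  -- so `B' < B`.
  induction B using Nat.strong_induction_on generalizing σ with
  | _ B ih =>
    by_cases hb : b.eval σ
    · obtain ⟨τ, T, h₁, B', hB, h₂⟩ := h B σ h₀ hb
      obtain ⟨υ, U, h₃, hU, hυ⟩ := ih B' (by omega) h₂
      exact ⟨υ, _, .whileTrue hb h₁ h₃, by omega, hυ⟩
    · exact ⟨σ, _, .whileFalse c hb, by omega, hb, B, h₀⟩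

/-! ### Memory that a command leaves alone -/

/-- Names of variables and arrays. -/
inductive Loc
  | nat (x : NVar)
  | real (x : RVar)
  | narr (a : NArr)
  | rarr (a : RArr)
  | mat (a : MArr)
  deriving DecidableEq

/-- Two memories have the same contents under a name. -/
def Loc.same (σ τ : State) : Loc → Prop
  | nat x => τ.nat x = σ.nat x
  | real x => τ.real x = σ.real x
  | narr a => τ.narr a = σ.narr a
  | rarr a => τ.rarr a = σ.rarr a
  | mat a => τ.mat a = σ.mat a

theorem Loc.same_refl (σ : State) (x : Loc) : x.same σ σ := by
  cases x <;> rfl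

theorem Loc.same_trans {σ τ υ : State} {x : Loc} (h : x.same σ τ) (h' : x.same τ υ) :
    x.same σ υ := by
  cases x <;> exact Eq.trans h' h

theorem Loc.same_setN (σ : State) {x : NVar} (v : ℕ) {y : Loc} (h : y ≠ .nat x) :
    y.same σ (σ.setN x v) := by
  cases y with
  | nat y =>
    have : y ≠ x := fun hy => h (by rw [hy])
    simp [Loc.same, State.setN, this]
  | _ => rfl

/-- The command contains no assignment to the name. -/
def Stmt.avoids (x : Loc) : Stmt → Bool
  | skip => true
  | setN y _ => decide (x ≠ .nat y)
  | setR y _ => decide (x ≠ .real y)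
  | putN a _ _ => decide (x ≠ .narr a)
  | putR a _ _ => decide (x ≠ .rarr a)
  | putM a _ _ _ => decide (x ≠ .mat a)
  | seq c d => c.avoids x && d.avoids x
  | ite _ c d => c.avoids x && d.avoids x
  | .while _ c => c.avoids x

/-- `τ` agrees with `σ` on all names that `c` does not assign to. -/
def Frame (c : Stmt) (σ τ : State) : Prop :=
  ∀ x : Loc, c.avoids x = true → x.same σ τ

theorem Frame.refl (c : Stmt) (σ : State) : Frame c σ σ := fun x _ => x.same_refl σ

theorem Frame.trans {c : Stmt} {σ τ υ : State} (h : Frame c σ τ) (h' : Frame c τ υ) :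
    Frame c σ υ := fun x hx => Loc.same_trans (h x hx) (h' x hx)

theorem Frame.weaken {c d : Stmt} {σ τ : State} (h : Frame c σ τ)
    (hcd : ∀ x, d.avoids x = true → c.avoids x = true) : Frame d σ τ :=
  fun x hx => h x (hcd x hx)

/-- Being free of assignments to a name is a Boolean computation. Later proofs obtain each unchanged
variable from a frame by `rfl`, and specifications mention only what changes. -/
theorem Exec.frame {c : Stmt} {σ τ : State} {T : ℕ} (h : Exec c σ τ T) : Frame c σ τ := by
  intro x
  induction h with
  | skip σ => exact fun _ => x.same_refl σ
  | setN y e σ => exact fun hx => Loc.same_setN _ _ (by simpa [Stmt.avoids] using hx)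
  | setR y e σ =>
    intro hx
    cases x <;> simp_all [Stmt.avoids, Loc.same, State.setR]
  | putN y e f σ =>
    intro hx
    cases x <;> simp_all [Stmt.avoids, Loc.same, State.putN]
  | putR y e f σ =>
    intro hx
    cases x <;> simp_all [Stmt.avoids, Loc.same, State.putR]
  | putM y e f v σ =>
    intro hx
    cases x <;> simp_all [Stmt.avoids, Loc.same, State.putM]
  | seq _ _ ih₁ ih₂ =>
    intro hx
    simp only [Stmt.avoids, Bool.and_eq_true] at hx
    exact Loc.same_trans (ih₁ hx.1) (ih₂ hx.2)
  | iteTrue _ _ _ ih =>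
    intro hx
    simp only [Stmt.avoids, Bool.and_eq_true] at hx
    exact ih hx.1
  | iteFalse _ _ _ ih =>
    intro hx
    simp only [Stmt.avoids, Bool.and_eq_true] at hx
    exact ih hx.2
  | whileFalse _ _ => exact fun _ => x.same_refl _
  | whileTrue _ _ _ ih₁ ih₂ => exact fun hx => Loc.same_trans (ih₁ hx) (ih₂ hx)

theorem Run.frame {c : Stmt} {σ : State} {Q : State → ℕ → Prop} (h : Run c σ Q) :
    Run c σ fun τ T => Q τ T ∧ Frame c σ τ := by
  obtain ⟨τ, T, h, hq⟩ := h
  exact ⟨τ, T, h, hq, h.frame⟩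

/-! ### Counting loops -/

namespace MinEntropy

/-- A loop that counts upwards, with an invariant `I` and a bound `β` for the number of steps
still to be made. -/
theorem run_forUp {x : NVar} {a b : NExp} {body : Stmt} {σ : State} {lo hi : ℕ}
    (I : ℕ → State → Prop) (β : ℕ → ℕ) (ha : a.eval σ = lo) (hle : lo ≤ hi + 1)
    (hb : ∀ τ, Frame (forUp x a b body) σ τ → b.eval τ = hi) (hx : body.avoids (.nat x) = true)
    (hI : ∀ v w τ, I v τ → I v (τ.setN x w)) (h₀ : I lo σ)
    (h : ∀ v τ, lo ≤ v → v ≤ hi → Frame (forUp x a b body) σ τ → τ.nat x = v → I v τ →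
      Run body τ fun υ T => T + β (v + 1) + b.cost + 8 ≤ β v ∧ I (v + 1) υ) :
    Run (forUp x a b body) σ fun τ T => T ≤ β lo + a.cost + b.cost + 6 ∧ I (hi + 1) τ := by
  have avoid : ∀ y, (forUp x a b body).avoids y = true →
      body.avoids y = true ∧ y ≠ .nat x := by
    intro y hy
    simpa [forUp, block, Stmt.avoids, and_comm] using hy
  have setx : ∀ τ w, Frame (forUp x a b body) σ τ →
      Frame (forUp x a b body) σ (τ.setN x w) := by
    intro τ w hτ y hy
    exact Loc.same_trans (hτ y hy) (Loc.same_setN _ _ (avoid y hy).2)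
  have key := run_while (b := .ile (.var x) b) (c := block [body, .setN x (.var x + 1)])
    (fun B τ => ∃ v, B = β v ∧ lo ≤ v ∧ v ≤ hi + 1 ∧ Frame (forUp x a b body) σ τ ∧
      τ.nat x = v ∧ I v τ) (B := β lo) (σ := σ.setN x lo) ?_
    ⟨lo, rfl, le_rfl, hle, setx _ _ (Frame.refl _ _), by simp [State.setN], hI _ _ _ h₀⟩
  · refine run_seq.2 (run_setN.2 (run_seq.2 ?_))
    rw [ha]
    refine key.mono fun τ T hT => run_skip.2 ?_
    obtain ⟨hT, hbT, _, v, -, h₁, h₂, hf, hv, hi'⟩ := hT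
    simp only [BExp.eval, NExp.eval, hb τ hf, hv, BExp.cost, NExp.cost] at hT hbT
    refine ⟨by omega, ?_⟩
    obtain rfl : v = hi + 1 := by omega
    exact hi'
  · rintro B τ ⟨v, rfl, h₁, h₂, hf, hv, hi'⟩ hbv
    simp only [BExp.eval, NExp.eval, hb τ hf, hv] at hbv
    refine run_seq.2 ((h v τ h₁ hbv hf hv hi').frame.mono ?_)
    rintro υ T ⟨⟨hT, hυ⟩, hfr⟩
    refine run_seq.2 (run_setN.2 (run_skip.2 ⟨β (v + 1), ?_, v + 1, rfl, ?_⟩))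
    -- Incrementing the counter takes `4` steps and the `skip` that closes the block `1`; with the
    -- `b.cost + 3` of the guard this makes the overhead `b.cost + 8`.
    · change _ + (T + ((1 + 1 + 1) + 1 + 1)) + _ ≤ _
      simp only [BExp.cost, NExp.cost]
      omega
    · have hυv : υ.nat x = v := (hfr (.nat x) hx).trans hv
      have : NExp.eval υ (.var x + 1) = v + 1 := by
        change υ.nat x + 1 = _
        rw [hυv]
      rw [this]
      exact ⟨by omega, by omega, setx _ _ (hf.trans (hfr.weaken fun y hy => (avoid y hy).1)),
        by simp [State.setN], hI _ _ _ hυ⟩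

/-- A loop that counts downwards, with an invariant `I` and a bound `β` for the number of steps
still to be made. The invariant `I v` holds when `v` is the next value of the counter. -/
theorem run_forDown {x : NVar} {a b : NExp} {body : Stmt} {σ : State} {lo hi : ℕ}
    (I : ℕ → State → Prop) (β : ℕ → ℕ) (ha : a.eval σ = hi) (hlo : 1 ≤ lo) (hle : lo ≤ hi + 1)
    (hb : ∀ τ, Frame (forDown x a b body) σ τ → b.eval τ = lo)
    (hx : body.avoids (.nat x) = true)
    (hI : ∀ v w τ, I v τ → I v (τ.setN x w)) (h₀ : I hi σ)
    (h : ∀ v τ, lo ≤ v + 1 → v + 1 ≤ hi → Frame (forDown x a b body) σ τ → τ.nat x = v + 1 →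
      I (v + 1) τ → Run body τ fun υ T => T + β v + b.cost + 8 ≤ β (v + 1) ∧ I v υ) :
    Run (forDown x a b body) σ fun τ T => T ≤ β hi + a.cost + b.cost + 6 ∧ I (lo - 1) τ := by
  have avoid : ∀ y, (forDown x a b body).avoids y = true →
      body.avoids y = true ∧ y ≠ .nat x := by
    intro y hy
    simpa [forDown, block, Stmt.avoids, and_comm] using hy
  have setx : ∀ τ w, Frame (forDown x a b body) σ τ →
      Frame (forDown x a b body) σ (τ.setN x w) := by
    intro τ w hτ y hy
    exact Loc.same_trans (hτ y hy) (Loc.same_setN _ _ (avoid y hy).2)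
  have key := run_while (b := .ile b (.var x)) (c := block [body, .setN x (.var x - 1)])
    (fun B τ => ∃ v, B = β v ∧ lo ≤ v + 1 ∧ v ≤ hi ∧ Frame (forDown x a b body) σ τ ∧
      τ.nat x = v ∧ I v τ) (B := β hi) (σ := σ.setN x hi) ?_
    ⟨hi, rfl, hle, le_rfl, setx _ _ (Frame.refl _ _), by simp [State.setN], hI _ _ _ h₀⟩
  · refine run_seq.2 (run_setN.2 (run_seq.2 ?_))
    rw [ha]
    refine key.mono fun τ T hT => run_skip.2 ?_
    obtain ⟨hT, hbT, _, v, -, h₁, h₂, hf, hv, hi'⟩ := hT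
    simp only [BExp.eval, NExp.eval, hb τ hf, hv, BExp.cost, NExp.cost] at hT hbT
    refine ⟨by omega, ?_⟩
    obtain rfl : v = lo - 1 := by omega
    exact hi'
  · rintro B τ ⟨v, rfl, h₁, h₂, hf, hv, hi'⟩ hbv
    simp only [BExp.eval, NExp.eval, hb τ hf, hv] at hbv
    -- Since `lo ≥ 1`, the counter is positive here and the truncated subtraction is a true
    -- decrement.
    obtain ⟨v, rfl⟩ : ∃ w, v = w + 1 := ⟨v - 1, by omega⟩
    refine run_seq.2 ((h v τ hbv h₂ hf hv hi').frame.mono ?_)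
    rintro υ T ⟨⟨hT, hυ⟩, hfr⟩
    refine run_seq.2 (run_setN.2 (run_skip.2 ⟨β v, ?_, v, rfl, ?_⟩))
    · change _ + (T + ((1 + 1 + 1) + 1 + 1)) + _ ≤ _
      simp only [BExp.cost, NExp.cost]
      omega
    · have hυv : υ.nat x = v + 1 := (hfr (.nat x) hx).trans hv
      have : NExp.eval υ (.var x - 1) = v := by
        change υ.nat x - 1 = _
        rw [hυv]
        rfl
      rw [this]
      exact ⟨by omega, by omega, setx _ _ (hf.trans (hfr.weaken fun y hy => (avoid y hy).1)),
        by simp [State.setN], hI _ _ _ hυ⟩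

end MinEntropy

/-! ### Exchanging the roles of rows and columns -/

def RArr.flip : RArr → RArr
  | p => q
  | q => p
  | sp => sq
  | sq => sp
  | R => C
  | C => R
  | smax => smax
  | z => z

def RExp.flip : RExp → RExp
  | zero => zero
  | var x => var x
  | get a e => get a.flip e
  | getm a e f => getm a f e
  | add e f => add e.flip f.flip
  | sub e f => sub e.flip f.flip

def BExp.flip : BExp → BExp
  | ieq e f => ieq e f
  | ile e f => ile e f
  | odd e => odd e
  | req e f => req e.flip f.flip
  | rle e f => rle e.flip f.flip
  | rlt e f => rlt e.flip f.flip
  | and a b => and a.flip b.flip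
  | not a => not a.flip

def Stmt.flip : Stmt → Stmt
  | skip => skip
  | setN x e => setN x e
  | setR x e => setR x e.flip
  | putN a e f => putN a e f
  | putR a e v => putR a.flip e v.flip
  | putM a e f v => putM a f e v.flip
  | seq c d => seq c.flip d.flip
  | ite b c d => ite b.flip c.flip d.flip
  | .while b c => .while b.flip c.flip

def State.flip (σ : State) : State :=
  { σ with
    rarr := fun a => σ.rarr a.flip
    mat := fun a i j => σ.mat a j i }

theorem RArr.flip_flip (a : RArr) : a.flip.flip = a := by
  cases a <;> rfl

theorem State.flip_flip (σ : State) : σ.flip.flip = σ := by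
  simp [State.flip, RArr.flip_flip]

theorem NExp.eval_flip (σ : State) (e : NExp) : e.eval σ.flip = e.eval σ := by
  induction e <;> simp_all [NExp.eval, State.flip]

theorem RExp.eval_flip (σ : State) (e : RExp) : e.flip.eval σ.flip = e.eval σ := by
  induction e with
  | get a e => simp only [RExp.eval, RExp.flip, NExp.eval_flip]; simp [State.flip, RArr.flip_flip]
  | getm a e f => simp only [RExp.eval, RExp.flip, NExp.eval_flip]; simp [State.flip]
  | _ => simp_all [RExp.eval, RExp.flip, State.flip]

theorem BExp.eval_flip (σ : State) (b : BExp) : b.flip.eval σ.flip ↔ b.eval σ := by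
  induction b <;> simp_all [BExp.eval, BExp.flip, NExp.eval_flip, RExp.eval_flip]

theorem RExp.cost_flip (e : RExp) : e.flip.cost = e.cost := by
  induction e <;> simp_all [RExp.cost, RExp.flip, Nat.add_comm]

theorem BExp.cost_flip (b : BExp) : b.flip.cost = b.cost := by
  induction b <;> simp_all [BExp.cost, BExp.flip, RExp.cost_flip]

theorem State.flip_putR (σ : State) (a : RArr) (i : ℕ) (v : ℝ) :
    (σ.putR a i v).flip = σ.flip.putR a.flip i v := by
  simp only [State.flip, State.putR, State.mk.injEq, true_and, and_true]
  funext b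
  have : b.flip = a ↔ b = a.flip := by
    constructor <;> rintro rfl <;> simp [RArr.flip_flip]
  simp only [Function.update_apply, this, RArr.flip_flip]

theorem State.flip_putM (σ : State) (a : MArr) (i j : ℕ) (v : ℝ) :
    (σ.putM a i j v).flip = σ.flip.putM a j i v := by
  simp only [State.flip, State.putM, State.mk.injEq, true_and]
  funext b k l
  by_cases hb : b = a <;> by_cases hk : k = j <;> by_cases hl : l = i <;>
    simp_all

/-- Flipping only renames arrays and transposes matrices, so an execution and its mirror image take
the same number of steps. -/
theorem Exec.flip {c : Stmt} {σ τ : State} {T : ℕ} (h : Exec c σ τ T) :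
    Exec c.flip σ.flip τ.flip T := by
  induction h with
  | skip σ => exact .skip _
  | setN x e σ =>
    have := Exec.setN x e σ.flip
    rwa [NExp.eval_flip] at this
  | setR x e σ =>
    have := Exec.setR x e.flip σ.flip
    rwa [RExp.eval_flip, RExp.cost_flip] at this
  | putN a e f σ =>
    have := Exec.putN a e f σ.flip
    rwa [NExp.eval_flip, NExp.eval_flip] at this
  | putR a e v σ =>
    have := Exec.putR a.flip e v.flip σ.flip
    rwa [NExp.eval_flip, RExp.eval_flip, RExp.cost_flip, ← State.flip_putR] at this
  | putM a e f v σ =>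
    have := Exec.putM a f e v.flip σ.flip
    rwa [NExp.eval_flip, NExp.eval_flip, RExp.eval_flip, RExp.cost_flip, ← State.flip_putM,
      Nat.add_comm f.cost] at this
  | seq _ _ ih₁ ih₂ => exact .seq ih₁ ih₂
  | iteTrue _ hb _ ih =>
    rw [← BExp.cost_flip]
    exact .iteTrue _ ((BExp.eval_flip _ _).2 hb) ih
  | iteFalse _ hb _ ih =>
    rw [← BExp.cost_flip]
    exact .iteFalse _ (mt (BExp.eval_flip _ _).1 hb) ih
  | whileFalse _ hb =>
    rw [← BExp.cost_flip]
    exact .whileFalse _ (mt (BExp.eval_flip _ _).1 hb)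
  | whileTrue hb _ _ ih₁ ih₂ =>
    rw [← BExp.cost_flip]
    exact .whileTrue ((BExp.eval_flip _ _).2 hb) ih₁ ih₂

theorem Run.flip {c : Stmt} {σ : State} {Q : State → ℕ → Prop} (h : Run c σ.flip Q) :
    Run c.flip σ fun τ T => Q τ.flip T := by
  obtain ⟨τ, T, h, hq⟩ := h
  have := h.flip
  rw [State.flip_flip] at this
  exact ⟨_, _, this, by simpa only [State.flip_flip] using hq⟩

/-- This transfers the specification of odd segments to even ones. -/
theorem MinEntropy.flip_oddSegment : oddSegment.flip = evenSegment := rfl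

/-! ### Entropy of single terms and the cost of splitting -/

open Finset in
/-- Changing one vanishing term of a sum. -/
theorem sum_update_of_zero {n w : ℕ} (hw : w ∈ Icc 1 n) {f : ℝ → ℝ} (hf : f 0 = 0) {g : ℕ → ℝ}
    (hg : g w = 0) (x : ℝ) :
    ∑ b ∈ Icc 1 n, f (if b = w then x else g b) = ∑ b ∈ Icc 1 n, f (g b) + f x := by
  have : ∀ b ∈ Icc 1 n,
      f (if b = w then x else g b) = f (g b) + if b = w then f x else 0 := by
    intro b _
    by_cases h : b = w
    · subst h; simp [hg, hf]
    · simp [h]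
  rw [sum_congr rfl this, sum_add_distrib, sum_ite_eq' (Icc 1 n) w, if_pos hw]

/-- The contribution of one probability to the entropy. -/
noncomputable def entropyTerm (x : ℝ) : ℝ := x * Real.logb 2 (1 / x)

theorem entropyTerm_zero : entropyTerm 0 = 0 := by simp [entropyTerm]

theorem entropyTerm_eq (x : ℝ) : entropyTerm x = Real.negMulLog x / Real.log 2 := by
  simp [entropyTerm, Real.negMulLog, Real.logb, neg_div, mul_div_assoc]

/-- Splitting a probability into two parts adds at most the probability to the entropy. -/
theorem entropyTerm_add_le {x y : ℝ} (hx : 0 ≤ x) (hy : 0 ≤ y) :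
    entropyTerm x + entropyTerm y ≤ entropyTerm (x + y) + (x + y) := by
  have h2 : 0 < Real.log 2 := Real.log_pos one_lt_two
  rcases hx.eq_or_lt with rfl | hx
  · simp [entropyTerm_zero, hy]
  rcases hy.eq_or_lt with rfl | hy
  · simp [entropyTerm_zero, hx.le]
  -- Concavity at the midpoint of `x` and `y`. Halving the argument `x + y` contributes `(x + y) *
  -- log 2`, that is, `x + y` bits.
  have h := Real.concaveOn_negMulLog.2 (Set.mem_Ici.2 hx.le) (Set.mem_Ici.2 hy.le)
    (by norm_num : (0 : ℝ) ≤ 1 / 2) (by norm_num : (0 : ℝ) ≤ 1 / 2) (by norm_num)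
  simp only [smul_eq_mul] at h
  have e : Real.negMulLog (1 / 2 * x + 1 / 2 * y)
      = (Real.negMulLog (x + y) + (x + y) * Real.log 2) / 2 := by
    rw [show 1 / 2 * x + 1 / 2 * y = (x + y) / 2 by ring, Real.negMulLog, Real.negMulLog,
      Real.log_div (by positivity) two_ne_zero]
    ring
  rw [e] at h
  simp only [entropyTerm_eq]
  rw [← add_div, ← sub_nonneg]
  have : Real.negMulLog (x + y) / Real.log 2 + (x + y)
      - (Real.negMulLog x + Real.negMulLog y) / Real.log 2
      = (Real.negMulLog (x + y) + (x + y) * Real.log 2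
        - (Real.negMulLog x + Real.negMulLog y)) / Real.log 2 := by
    field_simp
  rw [this]
  exact div_nonneg (by linarith) h2.le

/-! ### The invariant of the main loop -/

namespace MinEntropy

open Finset

/-- The suffix sums `sp`, `sq`, `u` of `p`, `q` and of a non-increasing `z`, with
`sp, sq ≤ u`. -/
structure Suffixes (n : ℕ) (p q z sp sq u : ℕ → ℝ) : Prop where
  p_eq : ∀ h, 1 ≤ h → h ≤ n → sp h = sp (h + 1) + p h
  q_eq : ∀ h, 1 ≤ h → h ≤ n → sq h = sq (h + 1) + q h
  z_eq : ∀ h, 1 ≤ h → h ≤ n → z h = u h - u (h + 1)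
  p_nonneg : ∀ h, 1 ≤ h → h ≤ n → 0 ≤ p h
  q_nonneg : ∀ h, 1 ≤ h → h ≤ n → 0 ≤ q h
  z_anti : ∀ g h, 1 ≤ g → g ≤ h → h ≤ n → z h ≤ z g
  le_p : ∀ h, 1 ≤ h → h ≤ n + 1 → sp h ≤ u h
  le_q : ∀ h, 1 ≤ h → h ≤ n + 1 → sq h ≤ u h

theorem Suffixes.flip {n : ℕ} {p q z sp sq u : ℕ → ℝ} (D : Suffixes n p q z sp sq u) :
    Suffixes n q p z sq sp u :=
  ⟨D.q_eq, D.p_eq, D.z_eq, D.q_nonneg, D.p_nonneg, D.z_anti, D.le_q, D.le_p⟩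

/-- The partial coupling `m` with the remainders `R`, in a segment of odd number that ends at `hi`,
when the indices above `v` have been dealt with. -/
structure PartialCoupling (n : ℕ) (p q z sp sq u : ℕ → ℝ) (hi v : ℕ) (m : ℕ → ℕ → ℝ)
    (R C : ℕ → ℝ) : Prop where
  m_nonneg : ∀ a ∈ Icc 1 n, ∀ b ∈ Icc 1 n, 0 ≤ m a b
  R_nonneg : ∀ a ∈ Icc 1 n, 0 ≤ R a
  C_zero : ∀ a ∈ Icc 1 n, C a = 0
  R_zero : ∀ a ∈ Icc 1 n, a ≤ v ∨ hi < a → R a = 0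
  R_le : ∀ a ∈ Icc 1 n, v < a → a ≤ hi → R a ≤ z a
  fresh : ∀ a ∈ Icc 1 n, ∀ b ∈ Icc 1 n, a < v ∨ b ≤ v → m a b = 0
  row : ∀ a ∈ Icc 1 n, v < a → ∑ b ∈ Icc 1 n, m a b + R a = p a
  col : ∀ b ∈ Icc 1 n, v < b → ∑ a ∈ Icc 1 n, m a b = q b
  -- Row `v` may already hold what the previous segment pushed over its lower end. Below the top of
  -- the segment `u = sp`, and this amount is zero.
  next_row : 1 ≤ v → ∑ b ∈ Icc 1 n, m v b = u (v + 1) - sp (v + 1)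
  -- The mass handled so far, in `m` and `R` together, is `u (v + 1)`; the completed columns hold
  -- `sq (v + 1)` of it.
  sum_R : ∑ a ∈ Icc 1 n, R a = u (v + 1) - sq (v + 1)
  entropy_le : ∑ a ∈ Icc 1 n, ∑ b ∈ Icc 1 n, entropyTerm (m a b)
    + ∑ a ∈ Icc 1 n, entropyTerm (R a) ≤ ∑ h ∈ Ioc v n, (entropyTerm (z h) + z h)

/-- Put `x` into the diagonal cell `v`, and the remainders `R (v + 1), …, R (L - 1)` into column
`v`. -/
def fillColumn (m : ℕ → ℕ → ℝ) (R : ℕ → ℝ) (v L : ℕ) (x : ℝ) : ℕ → ℕ → ℝ := fun a b =>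
  if b = v then (if a = v then x else if v < a ∧ a < L then R a else m a b) else m a b

/-- Remove the remainders `R (v + 1), …, R (L - 1)`, and set `R v` to `x`. -/
def updateRemainders (R : ℕ → ℝ) (v L : ℕ) (x : ℝ) : ℕ → ℝ := fun a =>
  if a = v then x else if v < a ∧ a < L then 0 else R a

section Step

variable {n : ℕ} {p q z sp sq u : ℕ → ℝ} {hi v w L : ℕ} {m : ℕ → ℕ → ℝ} {R C : ℕ → ℝ}

/-- A general `f` with `f 0 = 0` covers both uses of these sum formulas: the identity for the
marginals, `entropyTerm` for the entropy. -/
theorem sum_updateRemainders {f : ℝ → ℝ} (hf : f 0 = 0) (hv : v ∈ Icc 1 n) (hR : R v = 0)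
    (hL : L ≤ n + 1) (x : ℝ) :
    ∑ a ∈ Icc 1 n, f (updateRemainders R v L x a)
      = ∑ a ∈ Icc 1 n, f (R a) - ∑ a ∈ Ico (v + 1) L, f (R a) + f x := by
  have h : ∀ a ∈ Icc 1 n, f (updateRemainders R v L x a)
      = f (R a) - (if a ∈ Ico (v + 1) L then f (R a) else 0) + if a = v then f x else 0 := by
    intro a _
    have e : a ∈ Ico (v + 1) L ↔ v < a ∧ a < L := by simp
    rw [updateRemainders]
    by_cases h₁ : a = v
    · subst h₁; simp [hR, hf]
    · by_cases h₂ : v < a ∧ a < L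
      · rw [if_neg h₁, if_pos h₂, if_pos (e.2 h₂), if_neg h₁, hf]; ring
      · rw [if_neg h₁, if_neg h₂, if_neg (mt e.1 h₂), if_neg h₁]; ring
  have hs : Icc 1 n ∩ Ico (v + 1) L = Ico (v + 1) L := by
    refine inter_eq_right.2 fun a ha => ?_
    simp only [mem_Ico, mem_Icc] at ha ⊢
    omega
  rw [sum_congr rfl h, sum_add_distrib, sum_sub_distrib, sum_ite_mem, hs,
    sum_ite_eq' (Icc 1 n) v, if_pos hv]

theorem sum_fillColumn {f : ℝ → ℝ} (hf : f 0 = 0) (hv : v ∈ Icc 1 n) {a : ℕ} (hm : m a v = 0)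
    (x : ℝ) :
    ∑ b ∈ Icc 1 n, f (fillColumn m R v L x a b)
      = ∑ b ∈ Icc 1 n, f (m a b)
        + f (if a = v then x else if v < a ∧ a < L then R a else 0) := by
  rw [← sum_update_of_zero hv hf hm]
  refine sum_congr rfl fun b _ => ?_
  unfold fillColumn
  by_cases hb : b = v
  · subst hb; simp [hm]
  · simp [hb]

theorem sum_new_column {f : ℝ → ℝ} (hf : f 0 = 0) (hv : v ∈ Icc 1 n) (hL : L ≤ n + 1) (x : ℝ) :
    ∑ a ∈ Icc 1 n, f (if a = v then x else if v < a ∧ a < L then R a else 0)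
      = f x + ∑ a ∈ Ico (v + 1) L, f (R a) := by
  have h : ∀ a ∈ Icc 1 n, f (if a = v then x else if v < a ∧ a < L then R a else 0)
      = (if a = v then f x else 0) + (if a ∈ Ico (v + 1) L then f (R a) else 0) := by
    intro a _
    have e : a ∈ Ico (v + 1) L ↔ v < a ∧ a < L := by simp
    by_cases h₁ : a = v
    · subst h₁; simp
    · by_cases h₂ : v < a ∧ a < L
      · rw [if_neg h₁, if_pos h₂, if_pos (e.2 h₂), if_neg h₁, zero_add]
      · rw [if_neg h₁, if_neg h₂, if_neg (mt e.1 h₂), if_neg h₁, hf, zero_add]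
  have hs : Icc 1 n ∩ Ico (v + 1) L = Ico (v + 1) L := by
    refine inter_eq_right.2 fun a ha => ?_
    simp only [mem_Ico, mem_Icc] at ha ⊢
    omega
  rw [sum_congr rfl h, sum_add_distrib, sum_ite_mem, hs, sum_ite_eq' (Icc 1 n) v, if_pos hv]

/-- Column `w + 1` absorbs the remainders below `L`, of sum `s`, and is topped up to `q (w + 1)` by
a piece of `z (w + 1)`; the rest of `z (w + 1)` becomes a new remainder. What needs proof is that
both pieces are non-negative. -/
theorem PartialCoupling.step (D : Suffixes n p q z sp sq u)
    (P : PartialCoupling n p q z sp sq u hi (w + 1) m R C) (hwh : w + 1 ≤ hi) (hn : hi ≤ n)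
    (hu : u (w + 1) = sp (w + 1)) {s : ℝ} (hs : s = ∑ h ∈ Ico (w + 2) L, R h) (hL : w + 2 ≤ L)
    (hLh : L ≤ hi + 1) (h₁ : L = w + 2 ∨ s < q (w + 1)) (h₂ : L ≤ hi → q (w + 1) ≤ s + R L) :
    PartialCoupling n p q z sp sq u hi w (fillColumn m R (w + 1) L (q (w + 1) - s))
      (updateRemainders R (w + 1) L (z (w + 1) - (q (w + 1) - s))) C := by
  have hv : w + 1 ∈ Icc 1 n := mem_Icc.2 ⟨by omega, by omega⟩
  have hLn : L ≤ n + 1 := by omega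
  have hRv : R (w + 1) = 0 := P.R_zero _ hv (.inl le_rfl)
  have hmv : ∀ a ∈ Icc 1 n, m a (w + 1) = 0 := fun a ha => P.fresh a ha _ hv (.inr le_rfl)
  have hzv := D.z_eq (w + 1) (by omega) (by omega)
  have hqv := D.q_eq (w + 1) (by omega) (by omega)
  have hpv := D.p_eq (w + 1) (by omega) (by omega)
  have hzd : 0 ≤ q (w + 1) - s := by
    rcases h₁ with rfl | h₁
    · rw [Ico_self, sum_empty] at hs
      rw [hs, sub_zero]
      exact D.q_nonneg _ (by omega) (by omega)
    · linarith
  have hzr : 0 ≤ z (w + 1) - (q (w + 1) - s) := by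
    -- If all remainders were used, then `s = u (w + 2) - sq (w + 2)`, so the diagonal piece is `sq
    -- (w + 1) - u (w + 2) ≤ z (w + 1)`. Otherwise it is at most the next remainder `R L ≤ z L ≤ z
    -- (w + 1)`.
    rcases Nat.lt_or_ge hi L with h | h
    · obtain rfl : L = hi + 1 := by omega
      have e : s = ∑ a ∈ Icc 1 n, R a := by
        rw [hs]
        refine sum_subset (fun a ha => ?_) fun a ha ha' => P.R_zero a ha ?_
        · simp only [mem_Ico, mem_Icc] at ha ⊢
          omega
        · simp only [mem_Ico] at ha'
          omega
      have := D.le_q (w + 1) (by omega) (by omega)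
      rw [e, P.sum_R]
      linarith
    · have a₁ := h₂ h
      have a₂ := P.R_le L (mem_Icc.2 ⟨by omega, by omega⟩) (by omega) h
      have a₃ := D.z_anti (w + 1) L (by omega) (by omega) (by omega)
      linarith
  set zd := q (w + 1) - s with hzd'
  set zr := z (w + 1) - zd with hzr'
  have rows := fun {a : ℕ} (ha : a ∈ Icc 1 n) =>
    sum_fillColumn (f := id) (R := R) (L := L) rfl hv (hmv a ha) zd
  simp only [id] at rows
  have hother : ∀ a b, b ≠ w + 1 → fillColumn m R (w + 1) L zd a b = m a b := by
    intro a b hb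
    simp [fillColumn, hb]
  have hcol : ∀ a ∈ Icc 1 n, fillColumn m R (w + 1) L zd a (w + 1)
      = if a = w + 1 then zd else if w + 1 < a ∧ a < L then R a else 0 := by
    intro a ha
    simp [fillColumn, hmv a ha]
  have fresh : ∀ a ∈ Icc 1 n, ∀ b ∈ Icc 1 n, a ≤ w ∨ b ≤ w →
      fillColumn m R (w + 1) L zd a b = 0 := by
    intro a ha b hb h
    by_cases e : b = w + 1
    · subst e
      rw [hcol a ha, if_neg (by omega), if_neg (by omega)]
    · rw [hother a b e]
      exact P.fresh a ha b hb (by omega)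
  constructor
  · intro a ha b hb
    by_cases e : b = w + 1
    · subst e
      rw [hcol a ha]
      split_ifs
      exacts [hzd, P.R_nonneg a ha, le_rfl]
    · rw [hother a b e]
      exact P.m_nonneg a ha b hb
  · intro a ha
    unfold updateRemainders
    split_ifs
    exacts [hzr, le_rfl, P.R_nonneg a ha]
  · exact P.C_zero
  · intro a ha h
    unfold updateRemainders
    rw [if_neg (by omega)]
    split_ifs
    · rfl
    · exact P.R_zero a ha (by omega)
  · intro a ha h h'
    unfold updateRemainders
    split_ifs with h₃ h₄
    · subst h₃
      linarith
    · exact (P.R_nonneg a ha).trans (P.R_le a ha (by omega) h')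
    · exact P.R_le a ha (by omega) h'
  · exact fun a ha b hb h => fresh a ha b hb (by omega)
  · intro a ha h
    rw [rows ha]
    unfold updateRemainders
    by_cases e : a = w + 1
    · subst e
      -- The row receives `z (w + 1)` on top of the mass pushed into it: `u (w + 2) - sp (w + 2) + z
      -- (w + 1) = sp (w + 1) - sp (w + 2)`.
      rw [if_pos rfl, if_pos rfl, P.next_row (by omega)]
      linarith
    · have := P.row a ha (by omega)
      rw [if_neg e, if_neg e]
      split_ifs <;> linarith
  · intro b hb h
    by_cases e : b = w + 1
    · subst e
      have := sum_new_column (f := id) (R := R) rfl hv hLn zd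
      simp only [id] at this
      rw [sum_congr rfl hcol, this, ← hs]
      ring
    · rw [← P.col b hb (by omega)]
      exact sum_congr rfl fun a _ => hother a b e
  · intro h
    rw [hu, sub_self]
    exact sum_eq_zero fun b hb => fresh w (mem_Icc.2 ⟨h, by omega⟩) b hb (.inl le_rfl)
  · have := sum_updateRemainders (f := id) rfl hv hRv hLn zr
    simp only [id] at this
    rw [this, ← hs, P.sum_R]
    linarith
  · rw [sum_updateRemainders entropyTerm_zero hv hRv hLn,
      sum_congr rfl fun a ha => sum_fillColumn entropyTerm_zero hv (hmv a ha) zd, sum_add_distrib,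
      sum_new_column entropyTerm_zero hv hLn]
    have e : Ioc w n = insert (w + 1) (Ioc (w + 1) n) := by
      ext a
      simp only [mem_Ioc, mem_insert]
      simp only [mem_Icc] at hv
      omega
    rw [e, sum_insert (by simp)]
    -- Remainders that move into the column keep their size, so the only new entropy comes from the
    -- two pieces of `z (w + 1)`.
    have h₃ := entropyTerm_add_le hzd hzr
    rw [show zd + zr = z (w + 1) by rw [hzr']; ring] at h₃
    linarith [P.entropy_le]

/-- Move the remainders `R lo, …, R hi` to the column `v`. -/
noncomputable def carryColumn (m : ℕ → ℕ → ℝ) (R : ℕ → ℝ) (lo hi v : ℕ) : ℕ → ℕ → ℝ := fun a b =>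
  if b = v ∧ lo ≤ a ∧ a ≤ hi ∧ R a ≠ 0 then R a else m a b

/-- Remove the remainders `R lo, …, R hi`. -/
noncomputable def clearRemainders (R : ℕ → ℝ) (lo hi : ℕ) : ℕ → ℝ := fun a =>
  if lo ≤ a ∧ a ≤ hi ∧ R a ≠ 0 then 0 else R a

/-- The leftover remainders have total `u (v + 1) - sq (v + 1)`. Put into column `v`, they are
exactly the `next_row` of the transposed problem, so the next segment can start with no remainders.
-/
theorem PartialCoupling.carry (P : PartialCoupling n p q z sp sq u hi v m R C) (hv : 1 ≤ v)
    (hvn : v ≤ n) (hu : u (v + 1) = sp (v + 1)) :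
    PartialCoupling n q p z sq sp u v v (fun a b => carryColumn m R (v + 1) hi v b a) C
      (clearRemainders R (v + 1) hi) := by
  have hv' : v ∈ Icc 1 n := mem_Icc.2 ⟨hv, hvn⟩
  have hmv : ∀ a ∈ Icc 1 n, m a v = 0 := fun a ha => P.fresh a ha _ hv' (.inr le_rfl)
  -- The range conditions and the test `R a ≠ 0` make no difference: where they fail, the remainder
  -- is zero and so is the cell.
  have hm : ∀ a ∈ Icc 1 n, ∀ b, carryColumn m R (v + 1) hi v a b
      = if b = v then R a else m a b := by
    intro a ha b
    unfold carryColumn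
    by_cases e : b = v
    · subst e
      by_cases h : b + 1 ≤ a ∧ a ≤ hi ∧ R a ≠ 0
      · simp [h]
      · rw [if_neg (by tauto), if_pos rfl, hmv a ha]
        by_contra h'
        exact h ⟨by by_contra; exact h' (P.R_zero a ha (by omega)).symm,
          by by_contra; exact h' (P.R_zero a ha (by omega)).symm, fun e => h' e.symm⟩
    · simp [e]
  -- Row `v` becomes column `v` of the transposed problem and must therefore be empty.
  have hnext : ∀ b ∈ Icc 1 n, m v b = 0 := by
    have h := P.next_row hv
    rw [hu, sub_self] at h
    exact (sum_eq_zero_iff_of_nonneg fun b hb => P.m_nonneg v hv' b hb).1 h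
  have hsum : ∀ {f : ℝ → ℝ}, f 0 = 0 → ∀ a ∈ Icc 1 n,
      ∑ b ∈ Icc 1 n, f (carryColumn m R (v + 1) hi v a b)
        = ∑ b ∈ Icc 1 n, f (m a b) + f (R a) := by
    intro f hf a ha
    rw [← sum_update_of_zero hv' hf (hmv a ha)]
    exact sum_congr rfl fun b _ => by rw [hm a ha]
  constructor
  · intro a _ b hb
    rw [hm b hb]
    split_ifs
    · exact P.R_nonneg b hb
    · exact P.m_nonneg b hb a (by assumption)
  · exact fun a ha => (P.C_zero a ha).ge
  · intro a ha
    unfold clearRemainders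
    split_ifs with h
    · rfl
    · by_contra h'
      exact h ⟨by by_contra; exact h' (P.R_zero a ha (by omega)),
        by by_contra; exact h' (P.R_zero a ha (by omega)), h'⟩
  · exact fun a ha _ => P.C_zero a ha
  · intro a _ h h'
    omega
  · intro a ha b hb h
    rw [hm b hb]
    split_ifs with e
    · exact P.R_zero b hb (by omega)
    · rcases h with h | h
      · exact P.fresh b hb a ha (.inr h.le)
      · rcases h.eq_or_lt with rfl | h
        · exact hnext a ha
        · exact P.fresh b hb a ha (.inl h)
  · intro b hb h
    rw [P.C_zero b hb, add_zero, ← P.col b hb h]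
    exact sum_congr rfl fun a ha => by rw [hm a ha, if_neg (by omega)]
  · intro a ha h
    exact (hsum (f := id) rfl a ha).trans (P.row a ha h)
  · intro _
    rw [← P.sum_R]
    exact sum_congr rfl fun a ha => by rw [hm a ha, if_pos rfl]
  · rw [hu, sub_self]
    exact sum_eq_zero P.C_zero
  · rw [sum_comm, sum_congr rfl (hsum entropyTerm_zero), sum_add_distrib,
      sum_eq_zero fun a ha => (congrArg entropyTerm (P.C_zero a ha)).trans entropyTerm_zero,
      add_zero]
    exact P.entropy_le

/-- The matrix `m` restricted to the indices `1, …, n` is a coupling of `p` and `q`, of entropy at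
most the entropy of `z` plus the sum of `z`. -/
structure FullCoupling (n : ℕ) (p q z : ℕ → ℝ) (m : ℕ → ℕ → ℝ) : Prop where
  m_nonneg : ∀ a ∈ Icc 1 n, ∀ b ∈ Icc 1 n, 0 ≤ m a b
  row : ∀ a ∈ Icc 1 n, ∑ b ∈ Icc 1 n, m a b = p a
  col : ∀ b ∈ Icc 1 n, ∑ a ∈ Icc 1 n, m a b = q b
  entropy_le : ∑ a ∈ Icc 1 n, ∑ b ∈ Icc 1 n, entropyTerm (m a b)
    ≤ ∑ h ∈ Icc 1 n, (entropyTerm (z h) + z h)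

theorem FullCoupling.flip (F : FullCoupling n p q z m) :
    FullCoupling n q p z fun a b => m b a :=
  ⟨fun a ha b hb => F.m_nonneg b hb a ha, F.col, F.row, by rw [sum_comm]; exact F.entropy_le⟩

/-- At `v = 0` the remainders sum to `u 1 - sq 1 = 0`; being non-negative, they all vanish. -/
theorem PartialCoupling.full (P : PartialCoupling n p q z sp sq u hi 0 m R C)
    (hu : u 1 = sq 1) : FullCoupling n p q z m := by
  have hR : ∀ a ∈ Icc 1 n, R a = 0 := by
    have h := P.sum_R
    rw [zero_add, hu, sub_self] at h
    exact (sum_eq_zero_iff_of_nonneg P.R_nonneg).1 h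
  refine ⟨P.m_nonneg, fun a ha => ?_, fun b hb => P.col b hb (mem_Icc.1 hb).1, ?_⟩
  · have := P.row a ha (mem_Icc.1 ha).1
    rwa [hR a ha, add_zero] at this
  · have := P.entropy_le
    rwa [sum_eq_zero fun a ha => (congrArg entropyTerm (hR a ha)).trans entropyTerm_zero,
      add_zero] at this

end Step

end MinEntropy

/-! ### Execution of one segment -/

namespace MinEntropy

@[simp] theorem eval_sub (σ : State) (e f : NExp) : (e - f).eval σ = e.eval σ - f.eval σ := rfl
@[simp] theorem eval_rsub (σ : State) (e f : RExp) : (e - f).eval σ = e.eval σ - f.eval σ := rfl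
@[simp] theorem cost_sub (e f : NExp) : (e - f).cost = e.cost + f.cost + 1 := rfl
@[simp] theorem cost_rsub (e f : RExp) : (e - f).cost = e.cost + f.cost + 1 := rfl

attribute [simp] NExp.eval RExp.eval BExp.eval NExp.cost RExp.cost BExp.cost
  State.setN State.setR State.putN State.putR State.putM
  run_skip run_setN run_setR run_putN run_putR run_putM run_seq run_ite

open Finset

/-- The call of the splitting procedure in a segment of odd number. -/
abbrev oddSplit : Stmt := split (.get .z j) (.get .q j) .R (j + 1) (inv (s - 1) - 1)

/-- The list `Q` is always the interval from `v + 1` to `L - 1`, so the single index `L` describes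
it. When `Q` is empty the guard was never true and gives no bound on `s`; this happens for instance
if `q v = 0`, and explains the alternative `L = v + 1`. -/
theorem run_oddSplit {σ : State} {v hi : ℕ} (hj : σ.nat .j = v)
    (hhi : σ.narr .inv (σ.nat .s - 1) = hi + 1) (hv : v ≤ hi) :
    Run oddSplit σ fun τ T => T ≤ 50 * (hi + 1) ∧ ∃ L, v + 1 ≤ L ∧ L ≤ hi + 1 ∧
      τ.nat .c = L - (v + 1) ∧ (∀ t, v + t < L → 1 ≤ t → τ.narr .Q t = v + t) ∧
      ∃ s, s = ∑ h ∈ Ico (v + 1) L, σ.rarr .R h ∧ (L = v + 1 ∨ s < σ.rarr .q v) ∧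
        (L ≤ hi → σ.rarr .q v ≤ s + σ.rarr .R L) ∧
        τ.real .zd = σ.rarr .q v - s ∧ τ.real .zr = σ.rarr .z v - (σ.rarr .q v - s) := by
  unfold oddSplit split
  simp only [block, run_seq, run_setN, run_setR]
  refine (run_while (fun B τ => ∃ L, B = 40 * (hi + 1 - L) ∧ v + 1 ≤ L ∧ L ≤ hi + 1 ∧
    τ.nat .l = L ∧ τ.nat .c = L - (v + 1) ∧ τ.nat .j = v ∧
    τ.narr .inv = σ.narr .inv ∧ τ.nat .s = σ.nat .s ∧ τ.rarr = σ.rarr ∧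
    (∀ t, v + t < L → 1 ≤ t → τ.narr .Q t = v + t) ∧
    τ.real .sum = ∑ h ∈ Ico (v + 1) L, σ.rarr .R h ∧
    (L = v + 1 ∨ τ.real .sum < σ.rarr .q v)) ?_
    (B := 40 * (hi + 1 - (v + 1))) ?_).mono ?_
  · rintro _ τ ⟨L, rfl, h₁, h₂, hl, hc, hj', hinv, hs, hr, hQ, hsum, -⟩ hb
    simp only [BExp.eval, NExp.eval, eval_sub, RExp.eval, hl, hinv, hs, hhi,
      hr, hj', Nat.add_sub_cancel] at hb
    simp only [run_seq, run_setN, run_setR, run_putN, run_skip]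
    refine ⟨40 * (hi + 1 - (L + 1)), ?_, L + 1, rfl, by omega, by omega, ?_, ?_, ?_, ?_, ?_, ?_,
      ?_, ?_, ?_⟩
    · simp
      omega
    · simp [hl]
    · simp [hc]
      omega
    · simp [hj']
    · simp [hinv]
    · simp [hs]
    · simp [hr]
    · intro t ht ht'
      simp only [State.setN, State.setR, State.putN, NExp.eval]
      simp only [Function.update_self, ne_eq, reduceCtorEq, not_false_eq_true,
        Function.update_of_ne, hc, hl]
      by_cases e : t = L - (v + 1) + 1
      · subst e
        rw [Function.update_self]
        omega
      · rw [Function.update_of_ne e]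
        exact hQ t (by omega) ht'
    · rw [sum_Ico_succ_top h₁]
      simp [hsum, hl, hr]
    · right
      simpa [hl, hr] using hb.2
  · refine ⟨v + 1, rfl, le_rfl, by omega, ?_⟩
    simp [hj]
  · rintro τ T ⟨hT, hb, _, L, rfl, h₁, h₂, hl, hc, hj', hinv, hs, hr, hQ, hsum, hlt⟩
    simp only [BExp.eval, NExp.eval, eval_sub, RExp.eval, hl, hinv, hs, hhi,
      hr, hj', Nat.add_sub_cancel] at hb
    simp only [run_skip]
    refine ⟨?_, L, h₁, h₂, by simp [hc], by simpa using hQ, τ.real .sum, hsum, hlt, ?_, ?_, ?_⟩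
    · simp at hT ⊢
      omega
    · intro hL
      by_contra h
      exact hb ⟨hL, not_le.1 h⟩
    · simp [hr, hj']
    · simp [hr, hj']

/-- The body of the loop over `j` in a segment of odd number. -/
abbrev oddStep : Stmt := block [
  oddSplit,
  forUp .t 1 c (block [
    .setN .l (.get .Q t),
    .putM .m l j (.get .R l),
    .putR .R l .zero]),
  .putM .m j j (.var .zd),
  .putR .R j (.var .zr)]

theorem run_oddStep {σ : State} {v hi : ℕ} (hj : σ.nat .j = v)
    (hhi : σ.narr .inv (σ.nat .s - 1) = hi + 1) (hv : v ≤ hi) :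
    Run oddStep σ fun τ T => T ≤ 100 * (hi + 1) ∧ ∃ L, v + 1 ≤ L ∧ L ≤ hi + 1 ∧
      ∃ s, s = ∑ h ∈ Ico (v + 1) L, σ.rarr .R h ∧ (L = v + 1 ∨ s < σ.rarr .q v) ∧
        (L ≤ hi → σ.rarr .q v ≤ s + σ.rarr .R L) ∧
        τ.mat .m = fillColumn (σ.mat .m) (σ.rarr .R) v L (σ.rarr .q v - s) ∧
        τ.rarr .R
          = updateRemainders (σ.rarr .R) v L (σ.rarr .z v - (σ.rarr .q v - s)) := by
  unfold oddStep
  simp only [block]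
  refine run_seq.2 ((run_oddSplit hj hhi hv).frame.mono ?_)
  rintro τ T ⟨⟨hT, L, h₁, h₂, hc, hQ, s, hs, hlt, hle, hzd, hzr⟩, hf⟩
  have hR : τ.rarr .R = σ.rarr .R := hf (.rarr .R) rfl
  have hm : τ.mat .m = σ.mat .m := hf (.mat .m) rfl
  have hj' : τ.nat .j = v := (hf (.nat .j) rfl).trans hj
  refine run_seq.2 ((run_forUp (lo := 1) (hi := L - (v + 1)) (fun t υ =>
    υ.mat .m = (fun a b => if b = v ∧ v < a ∧ a < v + t then σ.rarr .R a else σ.mat .m a b) ∧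
    υ.rarr .R = fun a => if v < a ∧ a < v + t then 0 else σ.rarr .R a)
    (fun t => 30 * (L - (v + t))) rfl (by omega) ?_ rfl ?_ ?_ ?_).frame.mono ?_)
  · exact fun υ hυ => (hυ (.nat .c) rfl).trans hc
  · exact fun t w υ h => h
  · constructor
    · funext a b
      rw [if_neg (by omega), hm]
    · funext a
      rw [if_neg (by omega), hR]
  · rintro t υ ht ht' hfr hυt ⟨hυm, hυR⟩
    have hυj : υ.nat .j = v := (hfr (.nat .j) rfl).trans hj'
    have hυQ : υ.narr .Q t = v + t := by
      rw [hfr (.narr .Q) rfl]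
      exact hQ t (by omega) ht
    simp only [run_seq, run_setN, run_putM, run_putR, run_skip]
    refine ⟨?_, ?_, ?_⟩
    · simp
      omega
    · funext a b
      simp only [State.setN, State.putM, State.putR, NExp.eval, RExp.eval, Function.update_self,
        ne_eq, reduceCtorEq, not_false_eq_true, Function.update_of_ne, hυt, hυj, hυQ]
      rw [hυm, hυR]
      by_cases ha : a = v + t
      · subst ha
        by_cases hb : b = v
        · subst hb
          simp
          intro h
          omega
        · simp [hb]
      · rw [Function.update_of_ne ha]
        have : a < v + (t + 1) ↔ a < v + t := by omega
        simp only [this]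
    · funext a
      simp only [State.setN, State.putM, State.putR, NExp.eval, RExp.eval, Function.update_self,
        ne_eq, reduceCtorEq, not_false_eq_true, Function.update_of_ne, hυt, hυQ]
      rw [hυR]
      by_cases ha : a = v + t
      · subst ha
        simp
        intro h
        omega
      · rw [Function.update_of_ne ha]
        have : a < v + (t + 1) ↔ a < v + t := by omega
        simp only [this]
  · rintro υ U ⟨⟨hU, hυm, hυR⟩, hfr⟩
    have hυj : υ.nat .j = v := (hfr (.nat .j) rfl).trans hj'
    have hυd : υ.real .zd = τ.real .zd := hfr (.real .zd) rfl
    have hυr : υ.real .zr = τ.real .zr := hfr (.real .zr) rfl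
    have hL : v + (L - (v + 1) + 1) = L := by omega
    rw [hL] at hυm hυR
    simp only [run_seq, run_putM, run_putR, run_skip]
    refine ⟨?_, L, h₁, h₂, s, hs, hlt, hle, ?_, ?_⟩
    · simp at hU ⊢
      omega
    · funext a b
      simp only [State.putM, State.putR, NExp.eval, RExp.eval, Function.update_self, hυj, hυd, hzd]
      rw [hυm]
      unfold fillColumn
      by_cases ha : a = v
      · subst ha
        by_cases hb : b = a <;> simp [hb]
      · rw [Function.update_of_ne ha]
        by_cases hb : b = v <;> simp [ha, hb]
    · funext a
      simp only [State.putM, State.putR, NExp.eval, RExp.eval, Function.update_self, hυj, hυr, hzr]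
      rw [hυR]
      unfold updateRemainders
      by_cases ha : a = v
      · subst ha
        simp
      · simp [ha]

theorem run_oddSegment {N lo hi : ℕ} {p q z sp sq u : ℕ → ℝ} (D : Suffixes N p q z sp sq u)
    {σ : State} (hz : σ.rarr .z = z) (hq : σ.rarr .q = q)
    (hlo : σ.narr .inv (σ.nat .s) = lo) (hhi : σ.narr .inv (σ.nat .s - 1) = hi + 1)
    (h₁ : 1 ≤ lo) (h₂ : lo ≤ hi + 1) (hn : hi ≤ N) (hu : ∀ h, lo ≤ h → h ≤ hi → u h = sp h)
    (hu' : u lo = sp lo)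
    (P : PartialCoupling N p q z sp sq u hi hi (σ.mat .m) (σ.rarr .R) (σ.rarr .C)) :
    Run oddSegment σ fun τ T => T ≤ 200 * (N + 1) * (hi + 2 - lo) ∧
      (lo = 1 → PartialCoupling N p q z sp sq u hi 0 (τ.mat .m) (τ.rarr .R) (τ.rarr .C)) ∧
      (lo ≠ 1 → PartialCoupling N q p z sq sp u (lo - 1) (lo - 1) (fun a b => τ.mat .m b a)
        (τ.rarr .C) (τ.rarr .R)) := by
  unfold oddSegment
  simp only [block]
  refine run_seq.2 ((run_forDown (lo := lo) (hi := hi) (body := oddStep) (fun v τ =>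
    PartialCoupling N p q z sp sq u hi v (τ.mat .m) (τ.rarr .R) (σ.rarr .C))
    (fun v => (100 * (hi + 1) + 20) * (v + 1 - lo)) ?_ h₁ h₂ ?_ rfl ?_ P ?_).frame.mono ?_)
  · simp [hhi]
  · intro τ hτ
    have e₁ : τ.narr .inv = σ.narr .inv := hτ (.narr .inv) rfl
    have e₂ : τ.nat .s = σ.nat .s := hτ (.nat .s) rfl
    simp [e₁, e₂, hlo]
  · exact fun _ _ _ h => h
  · intro v τ hv hv' hτ hj Pv
    have e₁ : τ.narr .inv = σ.narr .inv := hτ (.narr .inv) rfl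
    have e₂ : τ.nat .s = σ.nat .s := hτ (.nat .s) rfl
    have e₃ : τ.rarr .z = σ.rarr .z := hτ (.rarr .z) rfl
    have e₄ : τ.rarr .q = σ.rarr .q := hτ (.rarr .q) rfl
    refine (run_oddStep hj (by rw [e₁, e₂, hhi]) hv').mono ?_
    rintro υ T ⟨hT, L, g₁, g₂, s, hs, hlt, hle, hm, hR⟩
    rw [e₄, hq] at hlt hle hm hR
    rw [e₃, hz] at hR
    refine ⟨?_, ?_⟩
    · have : v + 1 + 1 - lo = (v + 1 - lo) + 1 := by omega
      rw [this, Nat.mul_add_one (100 * (hi + 1) + 20)]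
      simp
      omega
    · rw [hm, hR]
      exact Pv.step D hv' hn (hu _ hv hv') hs g₁ g₂ hlt hle
  · rintro τ T ⟨⟨hT, Pv⟩, hτ⟩
    have e₁ : τ.narr .inv = σ.narr .inv := hτ (.narr .inv) rfl
    have e₂ : τ.nat .s = σ.nat .s := hτ (.nat .s) rfl
    have e₃ : τ.rarr .C = σ.rarr .C := hτ (.rarr .C) rfl
    have hlen : (100 * (hi + 1) + 20) * (hi + 1 - lo) ≤ (120 * (N + 1)) * (hi + 1 - lo) :=
      Nat.mul_le_mul_right _ (by omega)
    -- The factor `hi + 2 - lo` exceeds the length of the segment by one, which pays for the fixed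
    -- overhead even of an empty segment.
    have hlen' : 200 * (N + 1) * (hi + 2 - lo)
        = 120 * (N + 1) * (hi + 1 - lo) + 80 * (N + 1) * (hi + 1 - lo) + 200 * (N + 1) := by
      rw [show hi + 2 - lo = (hi + 1 - lo) + 1 by omega]
      ring
    have hlen'' : 80 * (hi + 1 - lo) ≤ 80 * (N + 1) * (hi + 1 - lo) :=
      Nat.mul_le_mul_right _ (by omega)
    unfold when
    refine run_seq.2 (run_ite.2 ⟨fun hne => ?_, fun he => ?_⟩)
    · have hne' : lo ≠ 1 := by simpa [e₁, e₂, hlo] using hne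
      refine (run_forUp (lo := lo) (hi := hi) (fun v υ =>
        υ.mat .m = (fun a b => if b = lo - 1 ∧ lo ≤ a ∧ a < v ∧ τ.rarr .R a ≠ 0 then τ.rarr .R a
          else τ.mat .m a b) ∧
        υ.rarr .R = fun a => if lo ≤ a ∧ a < v ∧ τ.rarr .R a ≠ 0 then 0 else τ.rarr .R a)
        (fun v => 50 * (hi + 1 - v)) ?_ h₂ ?_ rfl ?_ ?_ ?_).frame.mono ?_
      · simp [e₁, e₂, hlo]
      · intro υ hυ
        have f₁ : υ.narr .inv = τ.narr .inv := hυ (.narr .inv) rfl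
        have f₂ : υ.nat .s = τ.nat .s := hυ (.nat .s) rfl
        simp [e₁, e₂, f₁, f₂, hhi]
      · exact fun _ _ _ h => h
      · constructor
        · funext a b
          rw [if_neg (by omega)]
        · funext a
          rw [if_neg (by omega)]
      · rintro v υ hv hv' hυ hl ⟨hm, hR⟩
        have f₁ : υ.narr .inv = τ.narr .inv := hυ (.narr .inv) rfl
        have f₂ : υ.nat .s = τ.nat .s := hυ (.nat .s) rfl
        have hRv : υ.rarr .R v = τ.rarr .R v := by
          rw [hR]
          simp
        have hlt : ∀ a, a ≠ v → (a < v + 1 ↔ a < v) := by omega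
        refine run_ite.2 ⟨fun h => ?_, fun h => ?_⟩
        · have h0 : τ.rarr .R v ≠ 0 := by simpa [hl, hRv] using h
          simp only [run_seq, run_putM, run_putR, run_skip]
          refine ⟨?_, ?_, ?_⟩
          · simp
            omega
          · funext a b
            simp only [State.putM, State.putR, NExp.eval, RExp.eval, Function.update_self, hl, f₁,
              f₂, e₁, e₂, hlo, eval_sub, hRv]
            rw [hm]
            by_cases ha : a = v
            · subst ha
              by_cases hb : b = lo - 1
              · subst hb
                simp [hv, h0]
              · simp [hb]
            · rw [Function.update_of_ne ha]
              simp only [hlt a ha]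
          · funext a
            simp only [State.putM, State.putR, NExp.eval, RExp.eval, Function.update_self, hl]
            rw [hR]
            by_cases ha : a = v
            · subst ha
              simp [hv, h0]
            · rw [Function.update_of_ne ha]
              simp only [hlt a ha]
        · have h0 : τ.rarr .R v = 0 := by simpa [hl, hRv] using h
          refine run_skip.2 ⟨?_, ?_, ?_⟩
          · simp
            omega
          · rw [hm]
            funext a b
            by_cases ha : a = v
            · subst ha
              simp [h0]
            · simp only [hlt a ha]
          · rw [hR]
            funext a
            by_cases ha : a = v
            · subst ha
              simp [h0]
            · simp only [hlt a ha]
      · rintro υ U ⟨⟨hU, hm, hR⟩, hυ⟩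
        have f₃ : υ.rarr .C = τ.rarr .C := hυ (.rarr .C) rfl
        refine run_skip.2 ⟨?_, fun h => absurd h hne', fun _ => ?_⟩
        · simp at hT hU ⊢
          omega
        · have := Pv.carry (by omega) (by omega)
            (by rwa [show lo - 1 + 1 = lo by omega])
          rw [show lo - 1 + 1 = lo by omega] at this
          rw [hm, hR, f₃, e₃]
          have hc : carryColumn (τ.mat .m) (τ.rarr .R) lo hi (lo - 1)
              = fun a b => if b = lo - 1 ∧ lo ≤ a ∧ a < hi + 1 ∧ τ.rarr .R a ≠ 0 then τ.rarr .R a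
                else τ.mat .m a b := by
            funext a b
            simp only [carryColumn, Nat.lt_succ_iff]
          have hc' : clearRemainders (τ.rarr .R) lo hi
              = fun a => if lo ≤ a ∧ a < hi + 1 ∧ τ.rarr .R a ≠ 0 then 0 else τ.rarr .R a := by
            funext a
            simp only [clearRemainders, Nat.lt_succ_iff]
          rwa [hc, hc'] at this
    · have he' : lo = 1 := by simpa [e₁, e₂, hlo] using he
      refine run_skip.2 (run_skip.2 ⟨?_, fun _ => ?_, fun h => absurd he' h⟩)
      · simp at hT ⊢
        omega
      · subst he'
        rw [e₃]
        exact Pv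

end MinEntropy

namespace MinEntropy

open Finset

theorem run_evenSegment {N lo hi : ℕ} {p q z sp sq u : ℕ → ℝ} (D : Suffixes N p q z sp sq u)
    {σ : State} (hz : σ.rarr .z = z) (hp : σ.rarr .p = p)
    (hlo : σ.narr .inv (σ.nat .s) = lo) (hhi : σ.narr .inv (σ.nat .s - 1) = hi + 1)
    (h₁ : 1 ≤ lo) (h₂ : lo ≤ hi + 1) (hn : hi ≤ N) (hu : ∀ h, lo ≤ h → h ≤ hi → u h = sq h)
    (hu' : u lo = sq lo)
    (P : PartialCoupling N q p z sq sp u hi hi (fun a b => σ.mat .m b a) (σ.rarr .C)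
      (σ.rarr .R)) :
    Run evenSegment σ fun τ T => T ≤ 200 * (N + 1) * (hi + 2 - lo) ∧
      (lo = 1 → PartialCoupling N q p z sq sp u hi 0 (fun a b => τ.mat .m b a) (τ.rarr .C)
        (τ.rarr .R)) ∧
      (lo ≠ 1 → PartialCoupling N p q z sp sq u (lo - 1) (lo - 1) (τ.mat .m)
        (τ.rarr .R) (τ.rarr .C)) := by
  rw [← flip_oddSegment]
  exact (run_oddSegment (σ := σ.flip) D.flip hz hp hlo hhi h₁ h₂ hn hu hu' P).flip

/-! ### Initialization -/

theorem run_clear {σ : State} {N : ℕ} (hN : σ.nat .n = N) :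
    Run clear σ fun τ T => T ≤ 100 * (N + 1) ^ 2 ∧
      (∀ a ∈ Icc 1 N, ∀ b ∈ Icc 1 N, τ.mat .m a b = 0) ∧
      (∀ a ∈ Icc 1 N, τ.rarr .R a = 0) ∧ ∀ a ∈ Icc 1 N, τ.rarr .C a = 0 := by
  unfold clear
  simp only [block]
  refine run_seq.2 ((run_forUp (lo := 1) (hi := N) (fun v τ =>
    ∀ a ∈ Icc 1 N, ∀ b ∈ Icc 1 N, a < v → τ.mat .m a b = 0)
    (fun v => (20 * N + 20) * (N + 1 - v)) rfl (by omega) ?_ rfl ?_ ?_ ?_).frame.mono ?_)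
  · exact fun τ hτ => (hτ (.nat .n) rfl).trans hN
  · exact fun _ _ _ h => h
  · intro a ha b _ h
    simp only [mem_Icc] at ha
    omega
  · intro v τ hv hv' hτ hi hI
    have hN' : τ.nat .n = N := (hτ (.nat .n) rfl).trans hN
    refine (run_forUp (lo := 1) (hi := N) (fun w υ =>
      ∀ a ∈ Icc 1 N, ∀ b ∈ Icc 1 N, a < v ∨ a = v ∧ b < w → υ.mat .m a b = 0)
      (fun w => 20 * (N + 1 - w)) rfl (by omega) ?_ rfl ?_ ?_ ?_).mono ?_
    · exact fun υ hυ => (hυ (.nat .n) rfl).trans hN'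
    · exact fun _ _ _ h => h
    · intro a ha b hb h
      simp only [mem_Icc] at hb
      exact hI a ha b (mem_Icc.2 hb) (by omega)
    · intro w υ hw hw' hυ hj hI'
      have hi' : υ.nat .i = v := (hυ (.nat .i) rfl).trans hi
      refine run_putM.2 ⟨?_, ?_⟩
      · simp
        omega
      · intro a ha b hb h
        simp only [State.putM, NExp.eval, RExp.eval, Function.update_self, hi', hj]
        by_cases e : a = v
        · subst e
          by_cases e' : b = w
          · subst e'
            simp
          · rw [Function.update_self, Function.update_of_ne e']
            exact hI' a ha b hb (by omega)
        · rw [Function.update_of_ne e]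
          exact hI' a ha b hb (by omega)
    · rintro υ T ⟨hT, hI'⟩
      refine ⟨?_, fun a ha b hb h => hI' a ha b hb ?_⟩
      · rw [show N + 1 - v = N + 1 - (v + 1) + 1 by omega, Nat.mul_add_one]
        simp at hT ⊢
        omega
      · simp only [mem_Icc] at hb
        omega
  · rintro τ T ⟨⟨hT, hI⟩, hτ⟩
    have hN' : τ.nat .n = N := (hτ (.nat .n) rfl).trans hN
    refine run_seq.2 ((run_forUp (lo := 1) (hi := N) (fun v υ =>
      ∀ a ∈ Icc 1 N, a < v → υ.rarr .R a = 0 ∧ υ.rarr .C a = 0)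
      (fun v => 30 * (N + 1 - v)) rfl (by omega) ?_ rfl ?_ ?_ ?_).frame.mono ?_)
    · exact fun υ hυ => (hυ (.nat .n) rfl).trans hN'
    · exact fun _ _ _ h => h
    · intro a ha h
      simp only [mem_Icc] at ha
      omega
    · intro v υ hv hv' hυ hi hI'
      simp only [run_seq, run_putR, run_skip]
      refine ⟨?_, fun a ha h => ?_⟩
      · simp
        omega
      · simp only [State.putR, NExp.eval, RExp.eval, hi]
        by_cases e : a = v
        · subst e
          simp
        · simpa [e] using hI' a ha (by omega)
    · rintro υ U ⟨⟨hU, hI'⟩, hυ⟩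
      have hm : υ.mat .m = τ.mat .m := hυ (.mat .m) rfl
      refine run_skip.2 ⟨?_, ?_, fun a ha => (hI' a ha ?_).1, fun a ha => (hI' a ha ?_).2⟩
      · simp at hT hU ⊢
        nlinarith
      · rw [hm]
        exact fun a ha b hb => hI a ha b hb (by simp only [mem_Icc] at ha; omega)
      all_goals simp only [mem_Icc] at ha; omega

/-- Nothing is claimed about which orientation results. The later argument works for both; the wrong
one would merely make the first segment empty. -/
theorem run_orient {σ : State} {N : ℕ} (hN : σ.nat .n = N) :
    Run orient σ fun τ T => T ≤ 100 * (N + 1) ∧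
      (τ.nat .sw = 0 ∧ τ.rarr .p = σ.rarr .p ∧ τ.rarr .q = σ.rarr .q ∨
        τ.nat .sw = 1 ∧ ∀ a ∈ Icc 1 N, τ.rarr .p a = σ.rarr .q a ∧ τ.rarr .q a = σ.rarr .p a) := by
  unfold orient when
  simp only [block, run_seq, run_setN]
  refine (run_while (fun B τ => B = 20 * τ.nat .i) ?_ rfl).frame.mono ?_
  · rintro _ τ rfl ⟨hb, -⟩
    simp only [BExp.eval, NExp.eval] at hb
    refine run_setN.2 ⟨20 * (τ.nat .i - 1), ?_, ?_⟩
    · simp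
      omega
    · simp
  · rintro τ T ⟨⟨hT, -⟩, hτ⟩
    have hp : τ.rarr .p = σ.rarr .p := hτ (.rarr .p) rfl
    have hq : τ.rarr .q = σ.rarr .q := hτ (.rarr .q) rfl
    have hN' : τ.nat .n = N := (hτ (.nat .n) rfl).trans hN
    have hsw : τ.nat .sw = 0 := hτ (.nat .sw) rfl
    simp [hN] at hT
    refine run_ite.2 ⟨fun _ => ?_, fun _ => run_skip.2 (run_skip.2 ⟨?_, .inl ⟨hsw, hp, hq⟩⟩)⟩
    · simp only [run_seq, run_setN]
      refine (run_forUp (lo := 1) (hi := N) (fun v υ => ∀ a ∈ Icc 1 N,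
        if a < v then υ.rarr .p a = σ.rarr .q a ∧ υ.rarr .q a = σ.rarr .p a
        else υ.rarr .p a = σ.rarr .p a ∧ υ.rarr .q a = σ.rarr .q a)
        (fun v => 30 * (N + 1 - v)) rfl (by omega) ?_ rfl ?_ ?_ ?_).frame.mono ?_
      · exact fun υ hυ => (hυ (.nat .n) rfl).trans (by simpa using hN')
      · exact fun _ _ _ h => h
      · intro a ha
        simp only [mem_Icc] at ha
        rw [if_neg (by omega)]
        simp [hp, hq]
      · intro v υ hv hv' hυ hi hI
        simp only [run_seq, run_setR, run_putR, run_skip]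
        refine ⟨?_, fun a ha => ?_⟩
        · simp
          omega
        · have ha' := hI a ha
          have hv'' := hI v (mem_Icc.2 ⟨hv, hv'⟩)
          rw [if_neg (lt_irrefl v)] at hv''
          by_cases e : a = v
          · subst e
            rw [if_pos (by omega)]
            simp [hi, hv''.1, hv''.2]
          · have : a < v + 1 ↔ a < v := by omega
            simpa [hi, e, this] using ha'
      · rintro υ U ⟨⟨hU, hI⟩, hυ⟩
        have hsw' : υ.nat .sw = 1 := hυ (.nat .sw) rfl
        refine run_skip.2 (run_skip.2 ⟨?_, .inr ⟨hsw', fun a ha => ?_⟩⟩)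
        · simp at hU ⊢
          omega
        · have := hI a ha
          rwa [if_pos (by simp only [mem_Icc] at ha; omega)] at this
    · simp
      omega

theorem run_suffixSums {σ : State} {N : ℕ} (hN : σ.nat .n = N) :
    Run suffixSums σ fun τ T => T ≤ 100 * (N + 1) ∧
      τ.rarr .sp (N + 1) = 0 ∧ τ.rarr .sq (N + 1) = 0 ∧
      (∀ h, 1 ≤ h → h ≤ N → τ.rarr .sp h = τ.rarr .sp (h + 1) + σ.rarr .p h) ∧
      ∀ h, 1 ≤ h → h ≤ N → τ.rarr .sq h = τ.rarr .sq (h + 1) + σ.rarr .q h := by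
  unfold suffixSums
  simp only [block, run_seq, run_putR]
  refine (run_forDown (lo := 1) (hi := N) (fun v υ =>
    υ.rarr .sp (N + 1) = 0 ∧ υ.rarr .sq (N + 1) = 0 ∧
    (∀ h, v < h → h ≤ N → υ.rarr .sp h = υ.rarr .sp (h + 1) + σ.rarr .p h) ∧
    ∀ h, v < h → h ≤ N → υ.rarr .sq h = υ.rarr .sq (h + 1) + σ.rarr .q h)
    (fun v => 50 * v) ?_ le_rfl (by omega) ?_ rfl ?_ ?_ ?_).mono ?_
  · simpa using hN
  · exact fun _ _ => rfl
  · exact fun _ _ _ h => h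
  · refine ⟨by simp [hN], by simp [hN], fun h h₁ h₂ => ?_, fun h h₁ h₂ => ?_⟩ <;> omega
  · rintro v υ hv hv' hυ hi ⟨h₁, h₂, h₃, h₄⟩
    have hp : υ.rarr .p = σ.rarr .p := hυ (.rarr .p) rfl
    have hq : υ.rarr .q = σ.rarr .q := hυ (.rarr .q) rfl
    simp only [run_seq, run_putR, run_skip]
    refine ⟨?_, ?_, ?_, fun h g₁ g₂ => ?_, fun h g₁ g₂ => ?_⟩
    · simp
      omega
    · have : N + 1 ≠ v + 1 := by omega
      simp [hi, h₁, show N ≠ v by omega]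
    · simp [hi, h₂, show N ≠ v by omega]
    · by_cases e : h = v + 1
      · subst e
        simp [hi, hp]
      · simpa [hi, e, show h ≠ v by omega] using h₃ h (by omega) g₂
    · by_cases e : h = v + 1
      · subst e
        simp [hi, hq]
      · simpa [hi, e, show h ≠ v by omega] using h₄ h (by omega) g₂
  · rintro τ T ⟨hT, h₁, h₂, h₃, h₄⟩
    refine run_skip.2 ⟨?_, h₁, h₂, fun h g => h₃ h (by omega), fun h g => h₄ h (by omega)⟩
    simp at hT ⊢
    omega

theorem run_meet {σ : State} {N : ℕ} (hN : σ.nat .n = N) :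
    Run meet σ fun τ T => T ≤ 100 * (N + 1) ∧ τ.rarr .smax (N + 1) = 0 ∧
      (∀ h, 1 ≤ h → h ≤ N → τ.rarr .smax h = max (σ.rarr .sp h) (σ.rarr .sq h)) ∧
      ∀ h, 1 ≤ h → h ≤ N → τ.rarr .z h = τ.rarr .smax h - τ.rarr .smax (h + 1) := by
  unfold meet
  simp only [block, run_seq, run_putR]
  refine (run_forDown (lo := 1) (hi := N) (fun v υ =>
    υ.rarr .smax (N + 1) = 0 ∧
    (∀ h, v < h → h ≤ N → υ.rarr .smax h = max (σ.rarr .sp h) (σ.rarr .sq h)) ∧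
    ∀ h, v < h → h ≤ N → υ.rarr .z h = υ.rarr .smax h - υ.rarr .smax (h + 1))
    (fun v => 50 * v) ?_ le_rfl (by omega) ?_ rfl ?_ ?_ ?_).mono ?_
  · simpa using hN
  · exact fun _ _ => rfl
  · exact fun _ _ _ h => h
  · refine ⟨by simp [hN], fun h h₁ h₂ => ?_, fun h h₁ h₂ => ?_⟩ <;> omega
  · rintro v υ hv hv' hυ hi ⟨h₁, h₂, h₃⟩
    have hp : υ.rarr .sp = σ.rarr .sp := hυ (.rarr .sp) rfl
    have hq : υ.rarr .sq = σ.rarr .sq := hυ (.rarr .sq) rfl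
    simp only [run_seq, run_putR, run_skip, run_ite]
    constructor
    all_goals
      intro hb
      simp only [BExp.eval, RExp.eval, NExp.eval, hi, hp, hq] at hb
      refine ⟨?_, ?_, fun h g₁ g₂ => ?_, fun h g₁ g₂ => ?_⟩
      · simp
        omega
      · simp [hi, h₁, show N ≠ v by omega]
      · by_cases e : h = v + 1
        · subst e
          simp [hi, hp, hq]
          linarith
        · simpa [hi, e] using h₂ h (by omega) g₂
      · by_cases e : h = v + 1
        · subst e
          simp [hi]
        · simpa [hi, e, show h ≠ v by omega] using h₃ h (by omega) g₂
  · rintro τ T ⟨hT, h₁, h₂, h₃⟩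
    refine run_skip.2 ⟨?_, h₁, fun h g => h₂ h (by omega), fun h g => h₃ h (by omega)⟩
    simp at hT ⊢
    omega

/-! ### Inversion points -/

/-- The suffix sum of the vector whose turn it is in segments with the parity of `s` is at least
the other one. -/
def Dominates (sp sq : ℕ → ℝ) (s h : ℕ) : Prop :=
  (Odd s → sq h ≤ sp h) ∧ (¬ Odd s → sp h ≤ sq h)

/-- Hence an index that stops one segment belongs to the next, and no segment after the first is
empty. -/
theorem Dominates.succ_of_not {sp sq : ℕ → ℝ} {s h : ℕ} (H : ¬ Dominates sp sq s h) :
    Dominates sp sq (s + 1) h := by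
  unfold Dominates at *
  rw [Nat.odd_add_one]
  by_cases hs : Odd s
  · simp only [hs, true_imp_iff, not_true, false_imp_iff, and_true, true_and, not_le,
      not_false_iff] at H ⊢
    exact H.le
  · simp only [hs, true_imp_iff, not_true, false_imp_iff, and_true, true_and, not_le,
      not_false_iff] at H ⊢
    exact H.le

/-- The indices `x 0 = N + 1 ≥ x 1 ≥ ⋯ ≥ x K` bound the segments. -/
structure InversionPoints (N K : ℕ) (x : ℕ → ℕ) (sp sq : ℕ → ℝ) : Prop where
  first : x 0 = N + 1
  pos : ∀ s ≤ K, 1 ≤ x s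
  anti : ∀ s < K, x (s + 1) ≤ x s
  dominates : ∀ s < K, ∀ h, x (s + 1) ≤ h → h < x s → Dominates sp sq (s + 1) h
  dominates_self : ∀ s < K, Dominates sp sq (s + 1) (x (s + 1))
  ne_one : ∀ s < K, x s ≠ 1

theorem InversionPoints.extend {N K : ℕ} {x y : ℕ → ℕ} {sp sq : ℕ → ℝ}
    (H : InversionPoints N K x sp sq) (hK : x K ≠ 1) (hy : ∀ s ≤ K, y s = x s)
    (hpos : 1 ≤ y (K + 1)) (hle : y (K + 1) ≤ x K)
    (hdom : ∀ h, y (K + 1) ≤ h → h < x K → Dominates sp sq (K + 1) h)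
    (hself : Dominates sp sq (K + 1) (y (K + 1))) : InversionPoints N (K + 1) y sp sq := by
  constructor
  · rw [hy 0 (by omega)]
    exact H.first
  · intro s hs
    rcases hs.eq_or_lt with rfl | hs
    · exact hpos
    · rw [hy s (by omega)]
      exact H.pos s (by omega)
  · intro s hs
    rcases (Nat.lt_succ_iff.1 hs).eq_or_lt with rfl | hs
    · rwa [hy s le_rfl]
    · rw [hy s (by omega), hy (s + 1) (by omega)]
      exact H.anti s hs
  · intro s hs
    rcases (Nat.lt_succ_iff.1 hs).eq_or_lt with rfl | hs
    · rwa [hy s le_rfl]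
    · rw [hy s (by omega), hy (s + 1) (by omega)]
      exact H.dominates s hs
  · intro s hs
    rcases (Nat.lt_succ_iff.1 hs).eq_or_lt with rfl | hs
    · exact hself
    · rw [hy (s + 1) (by omega)]
      exact H.dominates_self s hs
  · intro s hs
    rcases (Nat.lt_succ_iff.1 hs).eq_or_lt with rfl | hs
    · rwa [hy s le_rfl]
    · rw [hy s (by omega)]
      exact H.ne_one s hs

theorem run_descend {σ : State} (a b : RArr) (hi : 1 ≤ σ.nat .i) :
    Run (.while (.and (.ile 2 i) (.rle (.get a (i - 1)) (.get b (i - 1)))) (.setN .i (i - 1))) σ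
      fun τ T => T ≤ 20 * (σ.nat .i + 1) ∧ 1 ≤ τ.nat .i ∧ τ.nat .i ≤ σ.nat .i ∧
        (∀ h, τ.nat .i ≤ h → h < σ.nat .i → σ.rarr a h ≤ σ.rarr b h) ∧
        (2 ≤ τ.nat .i → ¬ σ.rarr a (τ.nat .i - 1) ≤ σ.rarr b (τ.nat .i - 1)) := by
  refine (run_while (fun B τ => B = 20 * τ.nat .i ∧ 1 ≤ τ.nat .i ∧ τ.nat .i ≤ σ.nat .i ∧
    τ.rarr = σ.rarr ∧ ∀ h, τ.nat .i ≤ h → h < σ.nat .i → σ.rarr a h ≤ σ.rarr b h) ?_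
    ⟨rfl, hi, le_rfl, rfl, fun h h₁ h₂ => by omega⟩).mono ?_
  · rintro _ τ ⟨rfl, h₁, h₂, hr, h₃⟩ ⟨hb, hb'⟩
    simp only [BExp.eval, RExp.eval, NExp.eval, eval_sub, hr] at hb hb'
    refine run_setN.2 ⟨20 * (τ.nat .i - 1), ?_, ?_⟩
    · simp
      omega
    · simp only [State.setN, eval_sub, NExp.eval, Function.update_self]
      refine ⟨trivial, by omega, by omega, hr, fun h g₁ g₂ => ?_⟩
      by_cases e : h = τ.nat .i - 1
      · rwa [e]
      · exact h₃ h (by omega) g₂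
  · rintro τ T ⟨hT, hb, _, rfl, h₁, h₂, hr, h₃⟩
    refine ⟨?_, h₁, h₂, h₃, fun h₄ h₅ => hb ⟨h₄, ?_⟩⟩
    · simp at hT
      omega
    · simpa [hr] using h₅

theorem run_inversionPoints {σ : State} {N : ℕ} (hN : σ.nat .n = N) (hN1 : 1 ≤ N)
    (hsp : σ.rarr .sp (N + 1) = 0) (hsq : σ.rarr .sq (N + 1) = 0) :
    Run inversionPoints σ fun τ T => T ≤ 200 * (N + 2) ^ 2 ∧ 1 ≤ τ.nat .k ∧ τ.nat .k ≤ N + 1 ∧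
      τ.narr .inv (τ.nat .k) = 1 ∧
      InversionPoints N (τ.nat .k) (τ.narr .inv) (σ.rarr .sp) (σ.rarr .sq) := by
  unfold inversionPoints
  simp only [block, run_seq, run_setN, run_putN]
  refine (run_while (fun B τ => B = (50 * (N + 2)) * (N + 2 - τ.nat .k) ∧
    τ.rarr = σ.rarr ∧ τ.narr .inv (τ.nat .k) = τ.nat .i ∧
    -- Every segment but possibly the first lowers `i`, and `i ≤ N + 1` when `k = 1`; so `i + k`
    -- never exceeds `N + 2`, which bounds the number of segments by `N + 1`.
    (τ.nat .k = 0 ∨ τ.nat .i + τ.nat .k ≤ N + 2 ∧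
      (2 ≤ τ.nat .i → ¬ Dominates (σ.rarr .sp) (σ.rarr .sq) (τ.nat .k) (τ.nat .i - 1))) ∧
    InversionPoints N (τ.nat .k) (τ.narr .inv) (σ.rarr .sp) (σ.rarr .sq)) ?_
    (B := 50 * (N + 2) * (N + 2)) ?_).mono ?_
  · rintro _ τ ⟨rfl, hr, hinv, hk, H⟩ hb
    have hne : τ.nat .i ≠ 1 := hb
    have hpos := H.pos _ le_rfl
    rw [hinv] at hpos
    have hle : τ.nat .i ≤ N + 1 ∧ τ.nat .k ≤ N := by
      rcases hk with hk | ⟨hk, -⟩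
      · rw [hk, H.first] at hinv
        omega
      · have : τ.nat .k = 0 ∨ 0 < τ.nat .k := Nat.eq_zero_or_pos _
        rcases this with h | h
        · rw [h, H.first] at hinv
          omega
        · omega
    have key : Run (.ite (.odd k)
        (.while (.and (.ile 2 i) (.rle (.get .sq (i - 1)) (.get .sp (i - 1)))) (.setN .i (i - 1)))
        (.while (.and (.ile 2 i) (.rle (.get .sp (i - 1)) (.get .sq (i - 1)))) (.setN .i (i - 1))))
        (τ.setN .k (τ.nat .k + 1)) fun υ T => T ≤ 20 * (τ.nat .i + 1) + 10 ∧ 1 ≤ υ.nat .i ∧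
        υ.nat .i ≤ τ.nat .i ∧
        (∀ h, υ.nat .i ≤ h → h < τ.nat .i →
          Dominates (σ.rarr .sp) (σ.rarr .sq) (τ.nat .k + 1) h) ∧
        (2 ≤ υ.nat .i →
          ¬ Dominates (σ.rarr .sp) (σ.rarr .sq) (τ.nat .k + 1) (υ.nat .i - 1)) := by
      refine run_ite.2 ⟨fun h => ?_, fun h => ?_⟩
      · have ho : Odd (τ.nat .k + 1) := by simpa using h
        refine (run_descend .sq .sp (by simpa using hpos)).mono ?_
        rintro υ T ⟨hT, h₁, h₂, h₃, h₄⟩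
        simp [hr] at hT h₂ h₃ h₄
        refine ⟨by simp; omega, h₁, h₂, fun x g₁ g₂ => ⟨fun _ => h₃ x g₁ g₂, fun g => absurd ho g⟩,
          fun g₁ g₂ => absurd (g₂.1 ho) (not_le.2 (h₄ g₁))⟩
      · have ho : ¬ Odd (τ.nat .k + 1) := by simpa using h
        refine (run_descend .sp .sq (by simpa using hpos)).mono ?_
        rintro υ T ⟨hT, h₁, h₂, h₃, h₄⟩
        simp [hr] at hT h₂ h₃ h₄
        refine ⟨by simp; omega, h₁, h₂, fun x g₁ g₂ => ⟨fun g => absurd g ho, fun _ => h₃ x g₁ g₂⟩,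
          fun g₁ g₂ => absurd (g₂.2 ho) (not_le.2 (h₄ g₁))⟩
    simp only [run_seq, run_setN]
    refine key.frame.mono ?_
    rintro υ T ⟨⟨hT, h₁, h₂, h₃, h₄⟩, hf⟩
    have hkυ : υ.nat .k = τ.nat .k + 1 := (hf (.nat .k) rfl).trans (by simp)
    have hiυ : υ.narr .inv = τ.narr .inv := (hf (.narr .inv) rfl)
    have hrυ : υ.rarr = σ.rarr := by
      funext a
      rw [← hr]
      cases a
      exacts [hf (.rarr .p) rfl, hf (.rarr .q) rfl, hf (.rarr .sp) rfl, hf (.rarr .sq) rfl,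
        hf (.rarr .smax) rfl, hf (.rarr .z) rfl, hf (.rarr .R) rfl, hf (.rarr .C) rfl]
    simp only [run_putN, run_skip]
    refine ⟨(50 * (N + 2)) * (N + 2 - (τ.nat .k + 1)), ?_, ?_, ?_, ?_, ?_, ?_⟩
    · rw [show N + 2 - τ.nat .k = N + 2 - (τ.nat .k + 1) + 1 by omega, Nat.mul_add_one (50 * (N + 2))]
      simp
      omega
    · simp [hkυ]
    · simp [hrυ]
    · simp [hkυ]
    · right
      simp only [State.putN, hkυ]
      refine ⟨?_, h₄⟩
      rcases hk with hk | ⟨hk, hk'⟩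
      · rw [hk, H.first] at hinv
        omega
      · by_cases e : υ.nat .i = τ.nat .i
        · exfalso
          refine h₄ (by omega) ?_
          rw [e]
          exact Dominates.succ_of_not (hk' (by omega))
        · omega
    · have e₁ : ∀ s ≤ τ.nat .k, (υ.putN .inv (τ.nat .k + 1) (υ.nat .i)).narr .inv s
          = τ.narr .inv s := by
        intro s hs
        simp [hiυ, show s ≠ τ.nat .k + 1 by omega]
      have e₂ : (υ.putN .inv (τ.nat .k + 1) (υ.nat .i)).narr .inv (τ.nat .k + 1) = υ.nat .i := by
        simp
      have := H.extend (y := (υ.putN .inv (τ.nat .k + 1) (υ.nat .i)).narr .inv)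
        (by rwa [hinv]) e₁ (by rwa [e₂]) (by rwa [e₂, hinv]) (by rwa [e₂, hinv]) ?_
      · simpa [hkυ] using this
      · rw [e₂]
        -- If the segment is empty, it is the first one and its bound is `N + 1`, where both suffix
        -- sums vanish.
        by_cases e : υ.nat .i = τ.nat .i
        · rcases hk with hk | ⟨hk, hk'⟩
          · rw [hk, H.first] at hinv
            rw [e, ← hinv]
            unfold Dominates
            rw [hsp, hsq]
            exact ⟨fun _ => le_rfl, fun _ => le_rfl⟩
          · exact absurd (by rw [e]; exact Dominates.succ_of_not (hk' (by omega))) (h₄ (by omega))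
        · exact h₃ _ le_rfl (by omega)
  · refine ⟨?_, ?_, ?_, ?_, ?_⟩
    · simp
    · simp
    · simp
    · simp
    · constructor <;> simp [hN]
  · rintro τ T ⟨hT, hb, _, -, hr, hinv, hk, H⟩
    have hi : τ.nat .i = 1 := by simpa using hb
    have hk0 : τ.nat .k ≠ 0 := by
      intro h
      rw [h, H.first] at hinv
      omega
    refine run_skip.2 ⟨?_, by omega, by omega, by rw [hinv, hi], H⟩
    have h₁ : 50 * (N + 2) * (N + 2) = 50 * (N + 2) ^ 2 := by ring
    have h₂ : 2 ^ 2 ≤ (N + 2) ^ 2 := Nat.pow_le_pow_left (by omega) 2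
    simp only [BExp.cost, NExp.cost] at hT ⊢
    omega

end MinEntropy

/-! ### The main loop and the whole program -/

namespace MinEntropy

open Finset

/-- The suffix sums of a non-increasing vector are convex, and a maximum of convex sequences is
convex; this is why `z` is non-increasing. -/
theorem Suffixes.of_max {N : ℕ} {p q z sp sq u : ℕ → ℝ}
    (p_eq : ∀ h, 1 ≤ h → h ≤ N → sp h = sp (h + 1) + p h)
    (q_eq : ∀ h, 1 ≤ h → h ≤ N → sq h = sq (h + 1) + q h)
    (z_eq : ∀ h, 1 ≤ h → h ≤ N → z h = u h - u (h + 1))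
    (u_eq : ∀ h, 1 ≤ h → h ≤ N + 1 → u h = max (sp h) (sq h))
    (p_nonneg : ∀ h, 1 ≤ h → h ≤ N → 0 ≤ p h) (q_nonneg : ∀ h, 1 ≤ h → h ≤ N → 0 ≤ q h)
    (p_anti : ∀ h, 1 ≤ h → h + 1 ≤ N → p (h + 1) ≤ p h)
    (q_anti : ∀ h, 1 ≤ h → h + 1 ≤ N → q (h + 1) ≤ q h) : Suffixes N p q z sp sq u := by
  have le_p : ∀ h, 1 ≤ h → h ≤ N + 1 → sp h ≤ u h := fun h h₁ h₂ => by
    rw [u_eq h h₁ h₂]; exact le_max_left _ _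
  have le_q : ∀ h, 1 ≤ h → h ≤ N + 1 → sq h ≤ u h := fun h h₁ h₂ => by
    rw [u_eq h h₁ h₂]; exact le_max_right _ _
  refine ⟨p_eq, q_eq, z_eq, p_nonneg, q_nonneg, fun g h hg hgh => ?_, le_p, le_q⟩
  induction h, hgh using Nat.le_induction with
  | base => exact fun _ => le_rfl
  | succ h hgh ih =>
    intro hh
    refine le_trans ?_ (ih (by omega))
    have a₁ := le_p h (by omega) (by omega)
    have a₂ := le_q h (by omega) (by omega)
    have a₃ := le_p (h + 1 + 1) (by omega) (by omega)
    have a₄ := le_q (h + 1 + 1) (by omega) (by omega)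
    rw [z_eq h (by omega) (by omega), z_eq (h + 1) (by omega) (by omega)]
    -- Take the sequence that attains the maximum at `h + 1`. It lies below `u` at the two
    -- neighbours, so the second difference of `u` there is at least its own.
    rcases max_choice (sp (h + 1)) (sq (h + 1)) with e | e
    · rw [← u_eq (h + 1) (by omega) (by omega)] at e
      linarith [p_eq h (by omega) (by omega), p_eq (h + 1) (by omega) hh,
        p_anti h (by omega) hh]
    · rw [← u_eq (h + 1) (by omega) (by omega)] at e
      linarith [q_eq h (by omega) (by omega), q_eq (h + 1) (by omega) hh,
        q_anti h (by omega) hh]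

theorem run_segments {N K : ℕ} {p q z sp sq u : ℕ → ℝ} (D : Suffixes N p q z sp sq u)
    {σ : State} (hk : σ.nat .k = K) (hK : 1 ≤ K) (hKN : K ≤ N + 1) (hz : σ.rarr .z = z)
    (hp : σ.rarr .p = p) (hq : σ.rarr .q = q) (H : InversionPoints N K (σ.narr .inv) sp sq)
    (hinv : σ.narr .inv K = 1) (hsp : sp (N + 1) = 0) (hsq : sq (N + 1) = 0)
    (hu : ∀ h, 1 ≤ h → h ≤ N + 1 → u h = max (sp h) (sq h)) (h1 : sp 1 = sq 1)
    (hm : ∀ a ∈ Icc 1 N, ∀ b ∈ Icc 1 N, σ.mat .m a b = 0)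
    (hR : ∀ a ∈ Icc 1 N, σ.rarr .R a = 0) (hC : ∀ a ∈ Icc 1 N, σ.rarr .C a = 0) :
    Run (forUp .s 1 k (.ite (.odd s) oddSegment evenSegment)) σ fun τ T =>
      T ≤ 1000 * (N + 1) ^ 2 ∧ FullCoupling N p q z (τ.mat .m) := by
  have hanti : ∀ s ≤ K, σ.narr .inv s ≤ N + 1 := by
    intro s
    induction s with
    | zero => exact fun _ => H.first.le
    | succ s ih => exact fun hs => (H.anti s (by omega)).trans (ih (by omega))
  have hu1 : u 1 = sp 1 ∧ u 1 = sq 1 := by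
    rw [hu 1 le_rfl (by omega), h1]
    simp
  have odd_eq : ∀ {s h}, Odd s → Dominates sp sq s h → 1 ≤ h → h ≤ N + 1 → u h = sp h :=
    fun hs hd h₁ h₂ => by rw [hu _ h₁ h₂]; exact max_eq_left (hd.1 hs)
  have even_eq : ∀ {s h}, ¬ Odd s → Dominates sp sq s h → 1 ≤ h → h ≤ N + 1 → u h = sq h :=
    fun hs hd h₁ h₂ => by rw [hu _ h₁ h₂]; exact max_eq_right (hd.2 hs)
  refine (run_forUp (lo := 1) (hi := K) (fun s τ =>
    (s ≤ K → Odd s → PartialCoupling N p q z sp sq u (σ.narr .inv (s - 1) - 1)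
      (σ.narr .inv (s - 1) - 1) (τ.mat .m) (τ.rarr .R) (τ.rarr .C)) ∧
    (s ≤ K → ¬ Odd s → PartialCoupling N q p z sq sp u (σ.narr .inv (s - 1) - 1)
      (σ.narr .inv (s - 1) - 1) (fun a b => τ.mat .m b a) (τ.rarr .C) (τ.rarr .R)) ∧
    (K < s → FullCoupling N p q z (τ.mat .m)))
    -- The first term telescopes over the lengths of the segments; the second pays a fixed overhead
    -- for each of the `K + 1 - s` segments still to come.
    (fun s => 200 * (N + 1) * σ.narr .inv (s - 1) + (200 * (N + 1) + 20) * (K + 1 - s))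
    rfl (by omega) ?_ rfl ?_ ?_ ?_).mono ?_
  · exact fun τ hτ => (hτ (.nat .k) rfl).trans hk
  · exact fun _ _ _ h => h
  · refine ⟨fun _ _ => ?_, fun _ h => absurd odd_one h, fun h => absurd h (by omega)⟩
    simp only [Nat.sub_self, H.first, Nat.add_sub_cancel]
    have hmR : ∀ {x : ℕ → ℝ}, (∀ a ∈ Icc 1 N, x a = 0) → ∑ a ∈ Icc 1 N, x a = 0 :=
      fun h => sum_eq_zero h
    have hu0 : u (N + 1) = 0 := by
      rw [hu _ (by omega) le_rfl, hsp, hsq, max_self]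
    constructor
    · exact fun a ha b hb => (hm a ha b hb).ge
    · exact fun a ha => (hR a ha).ge
    · exact hC
    · exact fun a ha _ => hR a ha
    · exact fun a _ h h' => absurd h' (by omega)
    · exact fun a ha b hb _ => hm a ha b hb
    · exact fun a ha h => absurd (mem_Icc.1 ha).2 (by omega)
    · exact fun a ha h => absurd (mem_Icc.1 ha).2 (by omega)
    · intro h
      rw [hu0, hsp, sub_zero]
      exact sum_eq_zero (hm N (mem_Icc.2 ⟨h, le_rfl⟩))
    · rw [hu0, hsq, sub_zero]
      exact sum_eq_zero hR
    · rw [Ioc_self, sum_empty, sum_eq_zero fun a ha => sum_eq_zero fun b hb =>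
        (congrArg entropyTerm (hm a ha b hb)).trans entropyTerm_zero,
        sum_eq_zero fun a ha => (congrArg entropyTerm (hR a ha)).trans entropyTerm_zero, add_zero]
  · rintro s τ hs hsK hτ hsτ ⟨Io, Ie, -⟩
    obtain ⟨t, rfl⟩ : ∃ t, s = t + 1 := ⟨s - 1, by omega⟩
    have e₁ : τ.narr .inv = σ.narr .inv := hτ (.narr .inv) rfl
    have e₂ : τ.rarr .z = z := (hτ (.rarr .z) rfl).trans hz
    have e₃ : τ.rarr .p = p := (hτ (.rarr .p) rfl).trans hp
    have e₄ : τ.rarr .q = q := (hτ (.rarr .q) rfl).trans hq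
    simp only [Nat.add_sub_cancel] at Io Ie ⊢
    have b₁ := H.pos t (by omega)
    have b₂ := H.pos (t + 1) hsK
    have b₃ := H.anti t (by omega)
    have b₄ := hanti t (by omega)
    have hlo : τ.narr .inv (τ.nat .s) = σ.narr .inv (t + 1) := by rw [e₁, hsτ]
    have hhi : τ.narr .inv (τ.nat .s - 1) = σ.narr .inv t - 1 + 1 := by
      rw [e₁, hsτ, Nat.add_sub_cancel]
      omega
    have hlast : K < t + 1 + 1 → σ.narr .inv (t + 1) = 1 := by
      intro h
      obtain rfl : t + 1 = K := by omega
      exact hinv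
    have budget : ∀ T, T ≤ 200 * (N + 1) * (σ.narr .inv t - 1 + 2 - σ.narr .inv (t + 1)) →
        T + 5 + (200 * (N + 1) * σ.narr .inv (t + 1)
          + (200 * (N + 1) + 20) * (K + 1 - (t + 1 + 1))) + 10
        ≤ 200 * (N + 1) * σ.narr .inv t + (200 * (N + 1) + 20) * (K + 1 - (t + 1)) := by
      intro T hT
      have h₁ : 200 * (N + 1) * (σ.narr .inv t - 1 + 2 - σ.narr .inv (t + 1))
          + 200 * (N + 1) * σ.narr .inv (t + 1) = 200 * (N + 1) * σ.narr .inv t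
          + 200 * (N + 1) := by
        rw [← Nat.mul_add, ← Nat.mul_add_one]
        congr 1
        omega
      have h₂ : (200 * (N + 1) + 20) * (K + 1 - (t + 1))
          = (200 * (N + 1) + 20) * (K + 1 - (t + 1 + 1)) + (200 * (N + 1) + 20) := by
        rw [← Nat.mul_add_one]
        congr 1
        omega
      omega
    refine run_ite.2 ⟨fun ho => ?_, fun ho => ?_⟩
    · have ho' : Odd (t + 1) := by simpa [hsτ] using ho
      have ho'' : ¬ Odd (t + 1 + 1) := by rwa [Nat.odd_add_one, not_not]
      refine (run_oddSegment D e₂ e₄ hlo hhi b₂ (by omega) (by omega)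
        (fun h g₁ g₂ => odd_eq ho' (H.dominates t (by omega) h g₁ (by omega)) (by omega)
          (by omega)) (odd_eq ho' (H.dominates_self t (by omega)) b₂ (by omega))
        (Io hsK ho')).mono ?_
      rintro υ T ⟨hT, P₁, P₂⟩
      refine ⟨?_, fun _ h => absurd h ho'', fun h _ => P₂ (H.ne_one (t + 1) (by omega)),
        fun h => (P₁ (hlast h)).full hu1.2⟩
      have := budget T hT
      simp only [BExp.cost, NExp.cost]
      omega
    · have ho' : ¬ Odd (t + 1) := by simpa [hsτ] using ho
      have ho'' : Odd (t + 1 + 1) := by rwa [Nat.odd_add_one]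
      refine (run_evenSegment D e₂ e₃ hlo hhi b₂ (by omega) (by omega)
        (fun h g₁ g₂ => even_eq ho' (H.dominates t (by omega) h g₁ (by omega)) (by omega)
          (by omega)) (even_eq ho' (H.dominates_self t (by omega)) b₂ (by omega))
        (Ie hsK ho')).mono ?_
      rintro υ T ⟨hT, P₁, P₂⟩
      refine ⟨?_, fun h _ => P₂ (H.ne_one (t + 1) (by omega)), fun _ h => absurd ho'' h,
        fun h => ((P₁ (hlast h)).full hu1.1).flip⟩
      have := budget T hT
      simp only [BExp.cost, NExp.cost]
      omega
  · rintro τ T ⟨hT, -, -, hF⟩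
    refine ⟨?_, hF (by omega)⟩
    have h₁ : (200 * (N + 1) + 20) * K ≤ (220 * (N + 1)) * (N + 1) :=
      Nat.mul_le_mul (by omega) hKN
    have h₂ : 1 ≤ (N + 1) ^ 2 := Nat.one_le_pow _ _ (by omega)
    have h₃ : 200 * (N + 1) * (N + 1) = 200 * (N + 1) ^ 2 := by ring
    have h₄ : (220 * (N + 1)) * (N + 1) = 220 * (N + 1) ^ 2 := by ring
    simp only [Nat.sub_self, H.first, Nat.add_sub_cancel, NExp.cost] at hT
    omega

theorem run_writeOutput {σ : State} {N : ℕ} (hN : σ.nat .n = N) :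
    Run writeOutput σ fun τ T => T ≤ 100 * (N + 1) ^ 2 ∧ ∀ a ∈ Icc 1 N, ∀ b ∈ Icc 1 N,
      τ.mat .out a b = if σ.nat .sw = 0 then σ.mat .m a b else σ.mat .m b a := by
  unfold writeOutput
  refine (run_forUp (lo := 1) (hi := N) (fun v τ => ∀ a ∈ Icc 1 N, ∀ b ∈ Icc 1 N, a < v →
    τ.mat .out a b = if σ.nat .sw = 0 then σ.mat .m a b else σ.mat .m b a)
    (fun v => (30 * N + 30) * (N + 1 - v)) rfl (by omega) ?_ rfl ?_ ?_ ?_).mono ?_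
  · exact fun τ hτ => (hτ (.nat .n) rfl).trans hN
  · exact fun _ _ _ h => h
  · intro a ha b _ h
    simp only [mem_Icc] at ha
    omega
  · intro v τ hv hv' hτ hi hI
    have hN' : τ.nat .n = N := (hτ (.nat .n) rfl).trans hN
    have hm : τ.mat .m = σ.mat .m := hτ (.mat .m) rfl
    have hw : τ.nat .sw = σ.nat .sw := hτ (.nat .sw) rfl
    refine (run_forUp (lo := 1) (hi := N) (fun w υ => ∀ a ∈ Icc 1 N, ∀ b ∈ Icc 1 N,
      a < v ∨ a = v ∧ b < w →
        υ.mat .out a b = if σ.nat .sw = 0 then σ.mat .m a b else σ.mat .m b a)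
      (fun w => 30 * (N + 1 - w)) rfl (by omega) ?_ rfl ?_ ?_ ?_).mono ?_
    · exact fun υ hυ => (hυ (.nat .n) rfl).trans hN'
    · exact fun _ _ _ h => h
    · intro a ha b hb h
      simp only [mem_Icc] at hb
      exact hI a ha b (mem_Icc.2 hb) (by omega)
    · intro w υ hw₁ hw₂ hυ hj hI'
      have hi' : υ.nat .i = v := (hυ (.nat .i) rfl).trans hi
      have hm' : υ.mat .m = σ.mat .m := (hυ (.mat .m) rfl).trans hm
      have hw' : υ.nat .sw = σ.nat .sw := (hυ (.nat .sw) rfl).trans hw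
      simp only [run_ite, run_putM]
      constructor
      all_goals
        intro hb
        simp only [BExp.eval, NExp.eval, hw'] at hb
        refine ⟨?_, fun a ha b hb' h => ?_⟩
        · simp
          omega
        · by_cases e : a = v
          · subst e
            by_cases e' : b = w
            · subst e'
              simp [hi', hj, hm', hb]
            · simpa [hi', hj, hb, e'] using hI' a ha b hb' (by omega)
          · simpa [hi', e, hb] using hI' a ha b hb' (by omega)
    · rintro υ T ⟨hT, hI'⟩
      refine ⟨?_, fun a ha b hb h => hI' a ha b hb ?_⟩
      · rw [show N + 1 - v = N + 1 - (v + 1) + 1 by omega, Nat.mul_add_one]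
        simp at hT ⊢
        omega
      · simp only [mem_Icc] at hb
        omega
  · rintro τ T ⟨hT, hI⟩
    refine ⟨?_, fun a ha b hb => hI a ha b hb (by simp only [mem_Icc] at ha; omega)⟩
    simp at hT
    nlinarith

/-- The sum of the components with index at least `h`. -/
def suffixSum (N : ℕ) (p : ℕ → ℝ) (h : ℕ) : ℝ := ∑ a ∈ Icc h N, p a

/-- The vector whose suffix sums are the maxima of those of `p` and `q`. -/
noncomputable def meetVec (N : ℕ) (p q : ℕ → ℝ) (h : ℕ) : ℝ :=
  max (suffixSum N p h) (suffixSum N q h) - max (suffixSum N p (h + 1)) (suffixSum N q (h + 1))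

theorem meetVec_comm (N : ℕ) (p q : ℕ → ℝ) : meetVec N p q = meetVec N q p := by
  funext h
  simp only [meetVec, max_comm]

theorem suffixSum_top (N : ℕ) (p : ℕ → ℝ) : suffixSum N p (N + 1) = 0 := by
  simp [suffixSum]

theorem suffixSum_succ {N h : ℕ} (hh : h ≤ N) (p : ℕ → ℝ) :
    suffixSum N p h = suffixSum N p (h + 1) + p h := by
  rw [suffixSum, suffixSum, ← Finset.insert_Icc_succ_left_eq_Icc hh, sum_insert (by simp),
    add_comm]
  rfl

theorem suffixSum_congr {N h : ℕ} (hh : 1 ≤ h) {p q : ℕ → ℝ} (hpq : ∀ a ∈ Icc 1 N, p a = q a) :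
    suffixSum N p h = suffixSum N q h :=
  sum_congr rfl fun a ha => hpq a (by simp only [mem_Icc] at ha ⊢; omega)

theorem eq_suffixSum {N : ℕ} {p sp : ℕ → ℝ} (h0 : sp (N + 1) = 0)
    (hs : ∀ h, 1 ≤ h → h ≤ N → sp h = sp (h + 1) + p h) {h : ℕ} (h₁ : 1 ≤ h) (h₂ : h ≤ N + 1) :
    sp h = suffixSum N p h := by
  obtain ⟨d, hd⟩ : ∃ d, h + d = N + 1 := ⟨N + 1 - h, by omega⟩
  induction d generalizing h with
  | zero =>
    obtain rfl : h = N + 1 := hd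
    rw [h0, suffixSum_top]
  | succ d ih =>
    rw [hs h h₁ (by omega), suffixSum_succ (by omega), ih (by omega) (by omega) (by omega)]

theorem FullCoupling.congr {n : ℕ} {p p' q q' z z' : ℕ → ℝ} {m m' : ℕ → ℕ → ℝ}
    (F : FullCoupling n p q z m) (hp : ∀ a ∈ Icc 1 n, p' a = p a)
    (hq : ∀ a ∈ Icc 1 n, q' a = q a) (hz : ∀ a ∈ Icc 1 n, z' a = z a)
    (hm : ∀ a ∈ Icc 1 n, ∀ b ∈ Icc 1 n, m' a b = m a b) : FullCoupling n p' q' z' m' := by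
  refine ⟨fun a ha b hb => (F.m_nonneg a ha b hb).trans_eq (hm a ha b hb).symm,
    fun a ha => ?_, fun b hb => ?_, ?_⟩
  · rw [hp a ha, ← F.row a ha]
    exact sum_congr rfl (hm a ha)
  · rw [hq b hb, ← F.col b hb]
    exact sum_congr rfl fun a ha => hm a ha b hb
  · refine (sum_congr rfl fun a ha => sum_congr rfl fun b hb =>
      congrArg entropyTerm (hm a ha b hb)).trans_le (F.entropy_le.trans_eq ?_)
    exact sum_congr rfl fun a ha => by rw [hz a ha]

/-- A non-increasing vector of non-negative numbers of sum `1`, in the cells `1, …, N` of an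
array. -/
structure IsProbArray (N : ℕ) (p : ℕ → ℝ) : Prop where
  nonneg : ∀ h, 1 ≤ h → h ≤ N → 0 ≤ p h
  anti : ∀ h, 1 ≤ h → h + 1 ≤ N → p (h + 1) ≤ p h
  sum_eq_one : suffixSum N p 1 = 1

theorem IsProbArray.congr {N : ℕ} {p q : ℕ → ℝ} (hp : IsProbArray N p)
    (h : ∀ a ∈ Icc 1 N, q a = p a) : IsProbArray N q := by
  refine ⟨fun a h₁ h₂ => ?_, fun a h₁ h₂ => ?_, ?_⟩
  · rw [h a (mem_Icc.2 ⟨h₁, h₂⟩)]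
    exact hp.nonneg a h₁ h₂
  · rw [h a (mem_Icc.2 ⟨h₁, by omega⟩), h (a + 1) (mem_Icc.2 ⟨by omega, h₂⟩)]
    exact hp.anti a h₁ h₂
  · rw [suffixSum_congr le_rfl h, hp.sum_eq_one]

theorem run_algorithm {σ : State} {N : ℕ} (hN : σ.nat .n = N) (hN1 : 1 ≤ N) {p q : ℕ → ℝ}
    (hp : σ.rarr .p = p) (hq : σ.rarr .q = q) (Pp : IsProbArray N p) (Pq : IsProbArray N q) :
    Run algorithm σ fun τ T => T ≤ 4000 * (N + 1) ^ 2 ∧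
      FullCoupling N p q (meetVec N p q) (τ.mat .out) := by
  unfold algorithm
  simp only [block]
  refine run_seq.2 ((run_clear hN).frame.mono ?_)
  rintro σ₁ T₁ ⟨⟨hT₁, hm, hR, hC⟩, f₁⟩
  have hN₁ : σ₁.nat .n = N := (f₁ (.nat .n) rfl).trans hN
  refine run_seq.2 ((run_orient hN₁).frame.mono ?_)
  rintro σ₂ T₂ ⟨⟨hT₂, hsw⟩, f₂⟩
  rw [f₁ (.rarr .p) rfl, f₁ (.rarr .q) rfl, hp, hq] at hsw
  have hN₂ : σ₂.nat .n = N := (f₂ (.nat .n) rfl).trans hN₁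
  refine run_seq.2 ((run_suffixSums hN₂).frame.mono ?_)
  rintro σ₃ T₃ ⟨⟨hT₃, hsp, hsq, hps, hqs⟩, f₃⟩
  have hN₃ : σ₃.nat .n = N := (f₃ (.nat .n) rfl).trans hN₂
  refine run_seq.2 ((run_inversionPoints hN₃ hN1 hsp hsq).frame.mono ?_)
  rintro σ₄ T₄ ⟨⟨hT₄, hk, hk', hinv, H⟩, f₄⟩
  have hN₄ : σ₄.nat .n = N := (f₄ (.nat .n) rfl).trans hN₃
  have hsp₄ : σ₄.rarr .sp = σ₃.rarr .sp := f₄ (.rarr .sp) rfl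
  have hsq₄ : σ₄.rarr .sq = σ₃.rarr .sq := f₄ (.rarr .sq) rfl
  refine run_seq.2 ((run_meet hN₄).frame.mono ?_)
  rintro σ₅ T₅ ⟨⟨hT₅, hmax0, hmax, hz⟩, f₅⟩
  rw [hsp₄, hsq₄] at hmax
  have hp₅ : σ₅.rarr .p = σ₂.rarr .p :=
    (f₅ (.rarr .p) rfl).trans ((f₄ (.rarr .p) rfl).trans (f₃ (.rarr .p) rfl))
  have hq₅ : σ₅.rarr .q = σ₂.rarr .q :=
    (f₅ (.rarr .q) rfl).trans ((f₄ (.rarr .q) rfl).trans (f₃ (.rarr .q) rfl))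
  have hR₅ : σ₅.rarr .R = σ₁.rarr .R := (f₅ (.rarr .R) rfl).trans
    ((f₄ (.rarr .R) rfl).trans ((f₃ (.rarr .R) rfl).trans (f₂ (.rarr .R) rfl)))
  have hC₅ : σ₅.rarr .C = σ₁.rarr .C := (f₅ (.rarr .C) rfl).trans
    ((f₄ (.rarr .C) rfl).trans ((f₃ (.rarr .C) rfl).trans (f₂ (.rarr .C) rfl)))
  have hm₅ : σ₅.mat .m = σ₁.mat .m := (f₅ (.mat .m) rfl).trans
    ((f₄ (.mat .m) rfl).trans ((f₃ (.mat .m) rfl).trans (f₂ (.mat .m) rfl)))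
  have hk₅ : σ₅.nat .k = σ₄.nat .k := f₅ (.nat .k) rfl
  have hinv₅ : σ₅.narr .inv = σ₄.narr .inv := f₅ (.narr .inv) rfl
  have hsw₅ : σ₅.nat .sw = σ₂.nat .sw :=
    (f₅ (.nat .sw) rfl).trans ((f₄ (.nat .sw) rfl).trans (f₃ (.nat .sw) rfl))
  have hN₅ : σ₅.nat .n = N := (f₅ (.nat .n) rfl).trans hN₄
  have Pp₂ : IsProbArray N (σ₂.rarr .p) := by
    rcases hsw with ⟨-, h, -⟩ | ⟨-, h⟩
    · rwa [h]
    · exact Pq.congr fun a ha => (h a ha).1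
  have Pq₂ : IsProbArray N (σ₂.rarr .q) := by
    rcases hsw with ⟨-, -, h⟩ | ⟨-, h⟩
    · rwa [h]
    · exact Pp.congr fun a ha => (h a ha).2
  have hmax' : ∀ h, 1 ≤ h → h ≤ N + 1 →
      σ₅.rarr .smax h = max (σ₃.rarr .sp h) (σ₃.rarr .sq h) := by
    intro h h₁ h₂
    rcases h₂.eq_or_lt with rfl | h₂
    · rw [hmax0, hsp, hsq, max_self]
    · exact hmax h h₁ (by omega)
  have D := Suffixes.of_max hps hqs hz hmax' Pp₂.nonneg Pq₂.nonneg Pp₂.anti Pq₂.anti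
  have hsp' := fun {h} => eq_suffixSum (h := h) hsp hps
  have hsq' := fun {h} => eq_suffixSum (h := h) hsq hqs
  refine run_seq.2 ((run_segments D hk₅ hk hk' rfl hp₅ hq₅ (by rwa [hinv₅]) (by rwa [hinv₅]) hsp
    hsq hmax' ?_ (by rwa [hm₅]) (by rwa [hR₅]) (by rwa [hC₅])).frame.mono ?_)
  · rw [hsp' le_rfl (by omega), hsq' le_rfl (by omega), Pp₂.sum_eq_one, Pq₂.sum_eq_one]
  rintro σ₆ T₆ ⟨⟨hT₆, F⟩, f₆⟩
  have hN₆ : σ₆.nat .n = N := (f₆ (.nat .n) rfl).trans hN₅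
  have hsw₆ : σ₆.nat .sw = σ₂.nat .sw := (f₆ (.nat .sw) rfl).trans hsw₅
  refine run_seq.2 ((run_writeOutput hN₆).mono ?_)
  rintro σ₇ T₇ ⟨hT₇, hout⟩
  refine run_skip.2 ⟨?_, ?_⟩
  · have h₁ : (N + 2) ^ 2 ≤ 4 * (N + 1) ^ 2 := by nlinarith
    have h₂ : N + 1 ≤ (N + 1) ^ 2 := by nlinarith
    omega
  · have hz₅ : ∀ h ∈ Icc 1 N, meetVec N (σ₂.rarr .p) (σ₂.rarr .q) h = σ₅.rarr .z h := by
      intro h hh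
      simp only [mem_Icc] at hh
      rw [hz h hh.1 hh.2, hmax' h hh.1 (by omega), hmax' (h + 1) (by omega) (by omega),
        hsp' hh.1 (by omega), hsq' hh.1 (by omega), hsp' (by omega) (by omega),
        hsq' (by omega) (by omega)]
      rfl
    rw [hsw₆] at hout
    rcases hsw with ⟨h0, hp', hq'⟩ | ⟨h1, h⟩
    · rw [hp', hq'] at F hz₅
      refine F.congr (fun _ _ => rfl) (fun _ _ => rfl) hz₅ fun a ha b hb => ?_
      rw [hout a ha b hb, if_pos h0]
    · refine F.flip.congr (fun a ha => (h a ha).2.symm) (fun a ha => (h a ha).1.symm) ?_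
        fun a ha b hb => ?_
      · intro a ha
        rw [← hz₅ a ha, meetVec_comm]
        simp only [mem_Icc] at ha
        have e₁ := fun {x} (hx : 1 ≤ x) => suffixSum_congr hx fun a ha => (h a ha).1
        have e₂ := fun {x} (hx : 1 ≤ x) => suffixSum_congr hx fun a ha => (h a ha).2
        unfold meetVec
        rw [e₁ ha.1, e₂ ha.1, e₁ (x := a + 1) (by omega), e₂ (x := a + 1) (by omega)]
      · rw [hout a ha b hb, if_neg (by omega)]

end MinEntropy

/-! ### The meet of two ordered probability vectors, and the entropy bound for couplings -/

namespace OrdProb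

open Finset

variable {n : ℕ}

/-- The components of `p`, followed by zeros. -/
def extend (p : OrdProb n) (k : ℕ) : ℝ := if h : k < n then p.val ⟨k, h⟩ else 0

/-- The sum of the first `k` components of `p`. -/
def prefixSum (p : OrdProb n) (k : ℕ) : ℝ := ∑ a ∈ range k, p.extend a

theorem extend_nonneg (p : OrdProb n) (k : ℕ) : 0 ≤ p.extend k := by
  unfold extend
  split_ifs
  exacts [p.nonneg _, le_rfl]

theorem extend_val (p : OrdProb n) (i : Fin n) : p.extend i = p.val i := by
  simp [extend]

theorem extend_antitone (p : OrdProb n) : Antitone p.extend := by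
  intro a b hab
  unfold extend
  split_ifs with hb ha
  · exact p.antitone hab
  · omega
  · exact p.nonneg _
  · exact le_rfl

theorem prefixSum_succ (p : OrdProb n) (k : ℕ) :
    p.prefixSum (k + 1) = p.prefixSum k + p.extend k := sum_range_succ _ _

theorem prefixSum_zero (p : OrdProb n) : p.prefixSum 0 = 0 := sum_range_zero _

theorem prefixSum_self (p : OrdProb n) : p.prefixSum n = 1 := by
  rw [← p.sum_eq_one, prefixSum, sum_range]
  exact sum_congr rfl fun i _ => p.extend_val i

theorem prefixSum_of_le (p : OrdProb n) {k : ℕ} (h : n ≤ k) : p.prefixSum k = 1 := by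
  rw [← p.prefixSum_self, prefixSum, prefixSum]
  refine (sum_subset (range_mono h) fun a _ ha => ?_).symm
  rw [extend, dif_neg (by simpa using ha)]

theorem sum_Iic (p : OrdProb n) (i : Fin n) : ∑ j ∈ Iic i, p.val j = p.prefixSum (i + 1) := by
  have h : range (i + 1) = (Iic i).map Fin.valEmbedding := by
    rw [Fin.map_valEmbedding_Iic]
    ext a
    simp
  rw [prefixSum, h, sum_map]
  exact sum_congr rfl fun j _ => (p.extend_val j).symm

/-- The prefix sums of the meet of `p` and `q`. -/
noncomputable def minSum (p q : OrdProb n) (k : ℕ) : ℝ := min (p.prefixSum k) (q.prefixSum k)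

theorem minSum_mono (p q : OrdProb n) : Monotone (minSum p q) := by
  refine monotone_nat_of_le_succ fun k => min_le_min ?_ ?_
  · rw [prefixSum_succ]
    linarith [p.extend_nonneg k]
  · rw [prefixSum_succ]
    linarith [q.extend_nonneg k]

/-- Prefix sums of non-increasing vectors are concave, and so is the minimum of two concave
sequences. -/
theorem minSum_sub_antitone (p q : OrdProb n) :
    Antitone fun k => minSum p q (k + 1) - minSum p q k := by
  refine antitone_nat_of_succ_le fun k => ?_
  have hp : ∀ k, minSum p q k ≤ p.prefixSum k := fun k => min_le_left _ _
  have hq : ∀ k, minSum p q k ≤ q.prefixSum k := fun k => min_le_right _ _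
  rcases min_choice (p.prefixSum (k + 1)) (q.prefixSum (k + 1)) with e | e
  · have e' : minSum p q (k + 1) = p.prefixSum (k + 1) := e
    linarith [hp k, hp (k + 1 + 1), p.prefixSum_succ k, p.prefixSum_succ (k + 1),
      p.extend_antitone (Nat.le_succ k)]
  · have e' : minSum p q (k + 1) = q.prefixSum (k + 1) := e
    linarith [hq k, hq (k + 1 + 1), q.prefixSum_succ k, q.prefixSum_succ (k + 1),
      q.extend_antitone (Nat.le_succ k)]

/-- The greatest lower bound of `p` and `q`. -/
noncomputable def meet (p q : OrdProb n) : OrdProb n where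
  val i := minSum p q (i + 1) - minSum p q i
  nonneg i := sub_nonneg.2 (minSum_mono p q (Nat.le_succ i))
  sum_eq_one := by
    rw [← sum_range fun k => minSum p q (k + 1) - minSum p q k, sum_range_sub]
    simp [minSum, prefixSum_self, prefixSum_zero]
  antitone _ _ h := minSum_sub_antitone p q h

theorem prefixSum_meet (p q : OrdProb n) (k : ℕ) :
    (meet p q).prefixSum k = min (p.prefixSum k) (q.prefixSum k) := by
  rcases le_or_gt k n with h | h
  · have : (meet p q).prefixSum k = minSum p q k - minSum p q 0 := by
      rw [prefixSum, ← sum_range_sub]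
      refine sum_congr rfl fun a ha => ?_
      rw [extend, dif_pos (by simp only [mem_range] at ha; omega)]
      rfl
    rw [this]
    simp [minSum, prefixSum_zero]
  · simp [prefixSum_of_le _ h.le]

theorem isGLB_meet (p q : OrdProb n) : IsGLB {p, q} (meet p q) := by
  constructor
  · rintro x (rfl | rfl) i
    · rw [sum_Iic, sum_Iic, prefixSum_meet]
      exact min_le_left _ _
    · rw [sum_Iic, sum_Iic, prefixSum_meet]
      exact min_le_right _ _
  · intro w hw i
    have hp := hw (Set.mem_insert p {q}) i
    have hq := hw (Set.mem_insert_of_mem p rfl) i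
    rw [sum_Iic, sum_Iic] at *
    rw [prefixSum_meet]
    exact le_min hp hq

theorem sum_le_prefixSum (p : OrdProb n) (I : Finset (Fin n)) {k : ℕ} (h : I.card ≤ k) :
    ∑ i ∈ I, p.val i ≤ p.prefixSum k := by
  have key : ∀ S : Finset ℕ, ∑ a ∈ S, p.extend a ≤ p.prefixSum S.card := by
    intro S
    induction S using Finset.induction_on_max with
    | empty => simp [prefixSum]
    | insert a S hS ih =>
      have ha : a ∉ S := fun h => lt_irrefl _ (hS a h)
      -- All elements of `S` are smaller than the new maximum `a`, so `p.extend a` is at most the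
      -- component with index `S.card`, the next one in the prefix sum.
      have hc : S.card ≤ a := by
        simpa using card_le_card (fun b hb => mem_range.2 (hS b hb) : S ⊆ range a)
      rw [sum_insert ha, card_insert_of_notMem ha, prefixSum_succ]
      linarith [p.extend_antitone hc]
  have h₁ := key (I.map Fin.valEmbedding)
  rw [sum_map, card_map] at h₁
  simp only [Fin.valEmbedding_apply, extend_val] at h₁
  exact h₁.trans (sum_le_sum_of_subset_of_nonneg (range_mono h) fun a _ _ => p.extend_nonneg a)

end OrdProb

/-! ### Schur concavity of the entropy -/

open Finset in
/-- Entropy is Schur concave. -/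
theorem sum_entropyTerm_le_of_majorized {m : ℕ} {x y : ℕ → ℝ}
    (hx : ∀ a b, a ≤ b → b < m → x b ≤ x a) (hx0 : ∀ a < m, 0 ≤ x a) (hy0 : ∀ a < m, 0 ≤ y a)
    (hle : ∀ k ≤ m, ∑ a ∈ range k, x a ≤ ∑ a ∈ range k, y a)
    (heq : ∑ a ∈ range m, x a = ∑ a ∈ range m, y a) :
    ∑ a ∈ range m, entropyTerm (y a) ≤ ∑ a ∈ range m, entropyTerm (x a) := by
  have hsplit : ∀ {f : ℕ → ℝ}, (∀ a < m, 0 ≤ f a) → ∀ k ≤ m,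
      ∑ a ∈ range k, f a ≤ ∑ a ∈ range m, f a := fun hf k hk =>
    sum_le_sum_of_subset_of_nonneg (range_mono hk) fun a ha _ => hf a (mem_range.1 ha)
  -- Because `Real.log 0 = 0`, the logarithms of a non-increasing `x` are not monotone once `x`
  -- reaches zero. From there on, however, the partial sums of `y - x` vanish, and so does `y`.
  have hxtail : ∀ k < m, x k = 0 → ∑ a ∈ range k, x a = ∑ a ∈ range m, x a := by
    intro k hk h
    refine sum_subset (range_mono hk.le) fun a ha ha' => ?_
    simp only [mem_range, not_lt] at ha ha'
    exact le_antisymm (h ▸ hx k a ha' ha) (hx0 a ha)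
  have hdiff : ∀ k < m, x k = 0 → ∑ a ∈ range k, (y a - x a) = 0 := by
    intro k hk h
    rw [sum_sub_distrib]
    linarith [hxtail k hk h, hsplit hy0 k hk.le, hle k hk.le]
  have hyx : ∀ k < m, x k = 0 → y k = 0 := by
    intro k hk h
    have h₁ := hsplit hy0 (k + 1) hk
    rw [sum_range_succ] at h₁
    linarith [hxtail k hk h, hle k hk.le, hy0 k hk]
  -- Summation by parts: the partial sums of `y - x` are non-negative and `log (x k)` decreases as
  -- long as `x` is positive.
  have abel : ∀ k < m, (∑ a ∈ range (k + 1), (y a - x a)) * Real.log (x k)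
      ≤ ∑ a ∈ range (k + 1), (y a - x a) * Real.log (x a) := by
    intro k
    induction k with
    | zero => simp
    | succ k ih =>
      intro hk
      rw [sum_range_succ, sum_range_succ (fun a => (y a - x a) * Real.log (x a)), add_mul]
      refine add_le_add_left (le_trans ?_ (ih (by omega))) _
      rcases (hx0 (k + 1) hk).eq_or_lt with h | h
      · rw [hdiff (k + 1) hk h.symm]
        simp
      · refine mul_le_mul_of_nonneg_left (Real.log_le_log h (hx _ _ (by omega) hk)) ?_
        rw [sum_sub_distrib, sub_nonneg]
        exact hle _ (by omega)
  have habel : 0 ≤ ∑ a ∈ range m, (y a - x a) * Real.log (x a) := by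
    rcases m with _ | m
    · simp
    · refine le_trans ?_ (abel m (by omega))
      rw [sum_sub_distrib, heq, sub_self, zero_mul]
  -- Gibbs' inequality termwise, from `log t ≤ t - 1` at `t = x a / y a`. The corrections `x a - y
  -- a` cancel in the sum.
  have gibbs : ∀ a < m, Real.negMulLog (y a) ≤ -(y a * Real.log (x a)) + (x a - y a) := by
    intro a ha
    rcases (hx0 a ha).eq_or_lt with h | h
    · rw [hyx a ha h.symm, ← h]
      simp
    rcases (hy0 a ha).eq_or_lt with h' | h'
    · rw [← h']
      simpa using h.le
    have := Real.log_le_sub_one_of_pos (div_pos h h')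
    rw [Real.log_div h.ne' h'.ne'] at this
    have h₂ := mul_le_mul_of_nonneg_left this h'.le
    rw [mul_sub, mul_sub, mul_div_cancel₀ _ h'.ne'] at h₂
    rw [Real.negMulLog]
    linarith
  simp only [entropyTerm_eq, ← sum_div]
  refine div_le_div_of_nonneg_right ?_ (Real.log_pos one_lt_two).le
  refine (sum_le_sum fun a ha => gibbs a (mem_range.1 ha)).trans ?_
  rw [sum_add_distrib, sum_sub_distrib, heq, sub_self, add_zero]
  have : ∑ a ∈ range m, (y a - x a) * Real.log (x a)
      = ∑ a ∈ range m, Real.negMulLog (x a) - ∑ a ∈ range m, -(y a * Real.log (x a)) := by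
    rw [← sum_sub_distrib]
    exact sum_congr rfl fun a _ => by rw [Real.negMulLog]; ring
  linarith

/-! ### Lower bound for couplings and existence of the optimum -/

section Coupling

open Finset

variable {n : ℕ} {p q : OrdProb n} {M : Matrix (Fin n) (Fin n) ℝ}

theorem entropy_eq {ι : Type*} [Fintype ι] (x : ι → ℝ) : entropy x = ∑ i, entropyTerm (x i) := rfl

/-- Since `k` cells meet at most `k` rows, their sum is at most that of `k` components of `p`. -/
theorem sum_le_prefixSum_of_row (hM : ∀ i j, 0 ≤ M i j) (hr : ∀ i, ∑ j, M i j = p.val i)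
    (S : Finset (Fin n × Fin n)) {k : ℕ} (hS : S.card ≤ k) :
    ∑ a ∈ S, M a.1 a.2 ≤ p.prefixSum k := by
  calc ∑ a ∈ S, M a.1 a.2 ≤ ∑ a ∈ S.image Prod.fst ×ˢ univ, M a.1 a.2 := by
        refine sum_le_sum_of_subset_of_nonneg (fun a ha => ?_) fun a _ _ => hM _ _
        exact mem_product.2 ⟨mem_image_of_mem _ ha, mem_univ _⟩
    _ = ∑ i ∈ S.image Prod.fst, p.val i := by
        rw [sum_product]
        exact sum_congr rfl fun i _ => hr i
    _ ≤ p.prefixSum k := p.sum_le_prefixSum _ (card_image_le.trans hS)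

theorem sum_le_prefixSum_meet (hM : M ∈ couplings p q) (S : Finset (Fin n × Fin n)) {k : ℕ}
    (hS : S.card ≤ k) : ∑ a ∈ S, M a.1 a.2 ≤ (OrdProb.meet p q).prefixSum k := by
  obtain ⟨h0, hr, hc⟩ := hM
  rw [OrdProb.prefixSum_meet]
  refine le_min (sum_le_prefixSum_of_row h0 hr S hS) ?_
  have := sum_le_prefixSum_of_row (M := M.transpose) (p := q) (fun i j => h0 j i) hc
    (S.map (Equiv.prodComm _ _).toEmbedding) (k := k) (by rwa [card_map])
  rwa [sum_map] at this

/-- The entropy of a coupling is at least the entropy of the meet. -/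
theorem entropy_meet_le (hM : M ∈ couplings p q) :
    entropy (OrdProb.meet p q).val ≤ matEntropy M := by
  set z := OrdProb.meet p q
  -- The `n * n` entries of `M` are listed in non-increasing order as `x`, and compared with `z`
  -- padded by zeros to the same length.
  let f : Fin (n * n) → ℝ := fun a => M (finProdFinEquiv.symm a).1 (finProdFinEquiv.symm a).2
  let π := Tuple.sort fun a => -f a
  have hπ : Antitone (f ∘ π) := fun a b h => neg_le_neg_iff.1 (Tuple.monotone_sort (fun a => -f a) h)
  let e : Fin (n * n) ≃ Fin n × Fin n := π.trans finProdFinEquiv.symm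
  let x : ℕ → ℝ := fun a => if h : a < n * n then f (π ⟨a, h⟩) else 0
  have hxe : ∀ a : Fin (n * n), x a = M (e a).1 (e a).2 := fun a => dif_pos a.2
  have hxM : ∑ a ∈ range (n * n), entropyTerm (x a) = matEntropy M := by
    rw [sum_range]
    simp only [hxe]
    exact e.sum_comp fun a => entropyTerm (M a.1 a.2)
  have hzn : ∑ a ∈ range (n * n), entropyTerm (z.extend a) = entropy z.val := by
    rw [entropy_eq, ← sum_congr rfl fun i _ => congrArg entropyTerm (z.extend_val i),
      ← sum_range fun a => entropyTerm (z.extend a)]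
    refine (sum_subset (range_mono (Nat.le_mul_self n)) fun a _ ha => ?_).symm
    rw [OrdProb.extend, dif_neg (by simpa using ha), entropyTerm_zero]
  rw [← hxM, ← hzn]
  refine sum_entropyTerm_le_of_majorized ?_ ?_ (fun a _ => z.extend_nonneg a) ?_ ?_
  · intro a b hab hb
    simp only [x]
    rw [dif_pos hb, dif_pos (hab.trans_lt hb)]
    exact hπ hab
  · intro a ha
    simp only [x]
    rw [dif_pos ha]
    exact hM.1 _ _
  · intro k hk
    have hs : range k = (univ.filter fun a : Fin (n * n) => (a : ℕ) < k).map Fin.valEmbedding := by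
      ext a
      simp only [mem_range, mem_map, mem_filter, mem_univ, true_and, Fin.valEmbedding_apply]
      exact ⟨fun h => ⟨⟨a, h.trans_le hk⟩, h, rfl⟩, fun ⟨b, hb, hba⟩ => hba ▸ hb⟩
    have h := sum_le_prefixSum_meet hM
      ((univ.filter fun a : Fin (n * n) => (a : ℕ) < k).map e.toEmbedding) (k := k) (by
        rw [card_map, ← card_map Fin.valEmbedding, ← hs, card_range])
    rw [sum_map] at h
    refine le_trans (le_of_eq ?_) h
    rw [hs, sum_map]
    exact sum_congr rfl fun a _ => hxe a
  · have h₁ : ∑ a ∈ range (n * n), x a = 1 := by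
      rw [sum_range]
      simp only [hxe]
      rw [e.sum_comp fun a => M a.1 a.2, Fintype.sum_prod_type, ← p.sum_eq_one]
      exact sum_congr rfl fun i _ => hM.2.1 i
    rw [h₁]
    exact (z.prefixSum_of_le (Nat.le_mul_self n)).symm

theorem continuous_matEntropy : Continuous (matEntropy (n := n)) := by
  have : (matEntropy : Matrix (Fin n) (Fin n) ℝ → ℝ)
      = fun M => ∑ a : Fin n × Fin n, Real.negMulLog (M a.1 a.2) / Real.log 2 := by
    funext M
    exact sum_congr rfl fun a _ => entropyTerm_eq _
  rw [this]
  exact continuous_finsetSum _ fun a _ =>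
    (Real.continuous_negMulLog.comp (continuous_id.matrix_elem a.1 a.2)).div_const _

/-- With the continuity of the entropy, this is what makes `OPT` an attained minimum. -/
theorem isCompact_couplings (p q : OrdProb n) : IsCompact (couplings p q) := by
  have hc : IsCompact (Set.univ.pi fun _ : Fin n => Set.univ.pi fun _ : Fin n =>
      Set.Icc (0 : ℝ) 1) := isCompact_univ_pi fun _ => isCompact_univ_pi fun _ => isCompact_Icc
  refine hc.of_isClosed_subset ?_ ?_
  · simp only [couplings, Set.ofPred_and, Set.ofPred_forall]
    have hcont : ∀ i j, Continuous fun M : Matrix (Fin n) (Fin n) ℝ => M i j :=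
      fun i j => continuous_id.matrix_elem i j
    refine ((isClosed_iInter fun i => isClosed_iInter fun j => ?_).inter
      ((isClosed_iInter fun i => ?_).inter (isClosed_iInter fun j => ?_)))
    · exact isClosed_le continuous_const (hcont i j)
    · exact isClosed_eq (continuous_finsetSum _ fun j _ => hcont i j) continuous_const
    · exact isClosed_eq (continuous_finsetSum _ fun i _ => hcont i j) continuous_const
  · rintro M ⟨h0, hr, -⟩ i - j -
    refine ⟨h0 i j, ?_⟩
    calc M i j ≤ ∑ j, M i j := single_le_sum (fun j _ => h0 i j) (mem_univ j)
      _ = p.val i := hr i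
      _ ≤ ∑ i, p.val i := single_le_sum (fun i _ => p.nonneg i) (mem_univ i)
      _ = 1 := p.sum_eq_one

end Coupling

/-! ### From array cells `1, …, n` to vectors on `Fin n` -/

namespace MinEntropy

open Finset

theorem sum_Icc_eq_sum_fin (n : ℕ) (f : ℕ → ℝ) : ∑ a ∈ Icc 1 n, f a = ∑ i : Fin n, f (i + 1) := by
  rw [← sum_range fun a => f (a + 1), range_eq_Ico, sum_Ico_add' f 0 n 1]
  rfl

theorem forall_mem_Icc {n : ℕ} {P : ℕ → Prop} : (∀ a ∈ Icc 1 n, P a) ↔ ∀ i : Fin n, P (i + 1) := by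
  constructor
  · exact fun h i => h _ (mem_Icc.2 ⟨by omega, i.2⟩)
  · intro h a ha
    simp only [mem_Icc] at ha
    have := h ⟨a - 1, by omega⟩
    rwa [show a - 1 + 1 = a by omega] at this

variable {n : ℕ} {p q : OrdProb n} {f g : ℕ → ℝ}

theorem extend_eq (hf : ∀ i : Fin n, f (i + 1) = p.val i) {a : ℕ} (ha : a < n) :
    p.extend a = f (a + 1) := by
  rw [OrdProb.extend, dif_pos ha]
  exact (hf ⟨a, ha⟩).symm

theorem suffixSum_eq (hf : ∀ i : Fin n, f (i + 1) = p.val i) {k : ℕ} (hk : k ≤ n) :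
    suffixSum n f (k + 1) = 1 - p.prefixSum k := by
  induction k with
  | zero =>
    rw [p.prefixSum_zero, sub_zero, ← p.sum_eq_one, suffixSum, sum_Icc_eq_sum_fin]
    exact sum_congr rfl fun i _ => hf i
  | succ k ih =>
    have h := ih (by omega)
    rw [suffixSum_succ hk] at h
    rw [p.prefixSum_succ, extend_eq hf hk]
    linarith

theorem isProbArray (hf : ∀ i : Fin n, f (i + 1) = p.val i) : IsProbArray n f := by
  refine ⟨fun h h₁ h₂ => ?_, fun h h₁ h₂ => ?_, ?_⟩
  · obtain ⟨h, rfl⟩ : ∃ a, h = a + 1 := ⟨h - 1, by omega⟩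
    rw [← extend_eq hf h₂]
    exact p.extend_nonneg h
  · obtain ⟨h, rfl⟩ : ∃ a, h = a + 1 := ⟨h - 1, by omega⟩
    rw [← extend_eq hf h₂, ← extend_eq hf (by omega)]
    exact p.extend_antitone (by omega)
  · rw [suffixSum_eq hf (Nat.zero_le n), p.prefixSum_zero, sub_zero]

/-- Both vectors have total mass `1`, so a maximum of suffix sums is `1` minus a minimum of prefix
sums. -/
theorem meetVec_eq (hf : ∀ i : Fin n, f (i + 1) = p.val i) (hg : ∀ i : Fin n, g (i + 1) = q.val i)
    (i : Fin n) : meetVec n f g (i + 1) = (OrdProb.meet p q).val i := by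
  have h : ∀ k ≤ n, max (suffixSum n f (k + 1)) (suffixSum n g (k + 1))
      = 1 - OrdProb.minSum p q k := by
    intro k hk
    rw [suffixSum_eq hf hk, suffixSum_eq hg hk, OrdProb.minSum, max_sub_sub_left]
  rw [meetVec, h i i.2.le, h (i + 1) i.2]
  simp only [OrdProb.meet]
  ring

end MinEntropy

theorem theorem2 :
    ∃ K : ℕ, ∀ (n : ℕ) (p q : OrdProb n) (σ : State), MinEntropy.HasInput σ p q →
      ∃ (τ : State) (T : ℕ), Exec MinEntropy.algorithm σ τ T ∧ T ≤ K * n ^ 2 ∧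
        MinEntropy.result n τ ∈ couplings p q ∧
        (∃ z : OrdProb n, IsGLB {p, q} z ∧
          matEntropy (MinEntropy.result n τ) ≤ entropy z.val + 1) ∧
        (∃ opt : ℝ, IsLeast (matEntropy '' couplings p q) opt ∧
          matEntropy (MinEntropy.result n τ) ≤ opt + 1) := by
  -- The run takes at most `4000 * (n + 1) ^ 2` steps, and `n + 1 ≤ 2 * n` for `n ≥ 1`; the case `n
  -- = 0` is excluded because an empty sum is not `1`.
  refine ⟨16000, fun n p q σ ⟨hn, hin⟩ => ?_⟩
  have hn1 : 1 ≤ n := by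
    rcases n with _ | n
    · simpa using p.sum_eq_one
    · omega
  have hp := fun i => (hin i).1
  have hq := fun i => (hin i).2
  obtain ⟨τ, T, hE, hT, F⟩ :=
    MinEntropy.run_algorithm hn hn1 rfl rfl (MinEntropy.isProbArray hp) (MinEntropy.isProbArray hq)
  have hM : MinEntropy.result n τ ∈ couplings p q := by
    refine ⟨fun i j => MinEntropy.forall_mem_Icc.1 (MinEntropy.forall_mem_Icc.1 F.m_nonneg i) j, fun i => ?_,
      fun j => ?_⟩
    · have := MinEntropy.forall_mem_Icc.1 F.row i
      rwa [MinEntropy.sum_Icc_eq_sum_fin, hp] at this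
    · have := MinEntropy.forall_mem_Icc.1 F.col j
      rwa [MinEntropy.sum_Icc_eq_sum_fin, hq] at this
  have hH : matEntropy (MinEntropy.result n τ) ≤ entropy (OrdProb.meet p q).val + 1 := by
    have h := F.entropy_le
    simp only [MinEntropy.sum_Icc_eq_sum_fin, MinEntropy.meetVec_eq hp hq, Finset.sum_add_distrib] at h
    -- The splitting costs `z h` add up to one bit.
    rw [(OrdProb.meet p q).sum_eq_one] at h
    rw [matEntropy, entropy_eq, entropy_eq, Fintype.sum_prod_type]
    exact h
  refine ⟨τ, T, hE, ?_, hM, ⟨_, OrdProb.isGLB_meet p q, hH⟩, ?_⟩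
  · nlinarith
  · obtain ⟨opt, hopt⟩ := ((isCompact_couplings p q).image continuous_matEntropy).exists_isLeast
      ⟨_, _, hM, rfl⟩
    refine ⟨opt, hopt, ?_⟩
    obtain ⟨M, hM', rfl⟩ := hopt.1
    linarith [entropy_meet_le hM']
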